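/- **Setting.** Fix a finite set $PV$ of pointer variables with $\mathtt{nil}\in PV$, $k=|PV|$, a finite set $Y$ of universal variables and a data domain $\mathbb D$. *Heaps.* A heap skinny-tree (program configuration) $H$ consists of a finite set $Loc$ of locations containing a location $dirty$, a partial acyclic map $\mathtt{next}$ on $Loc$ that is undefined exactly at $dirty$, a map $\mathtt{data}:Loc\to\mathbb D$, and $pval:PV\to Loc$, such that every location is reachable by $\mathtt{next}$ from some $pval(p)$ and $\mathtt{next}(pval(\mathtt{nil}))=dirty$. It is regarded as a tree with root $dirty$ in which the children of $u$ are the locations $v$ with $\mathtt{next}(v)=u$, and $u$ is labelled with $\{p\mid pval(p)=u\}$ and $\mathtt{data}(u)$. A symbolic tree $t$ is such a tree without data, with in addition an injective placement of the variables of $Y$ on its nodes, so that a node carries a label in $2^{PV}\times(Y\cup\{-\})$; together with the data of $H$ it is a valuation tree of $H$. *Data formulas.* $F$ is a lattice of formulas over the data values $v\to\mathtt{data}$, $v\in PV\cup Y$; $\bot,\top$ are false and true, $\alpha\sqsubseteq\beta$ implies $\alpha\Rightarrow\beta$, $\sqcap$ is conjunction, distinct formulas are inequivalent, $F$ contains the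 equalities $v\to\mathtt{data}=w\to\mathtt{data}$ and is closed under $\varphi\mapsto\exists d.\,\varphi[v\to\mathtt{data}/d]$, and $F$ contains the formulas that the table below forms from the data expression or data predicate of the statement considered. *QSDAs.* A QSDA $\mathcal A=(Q,\Delta_0,\dots,\Delta_k,\mathcal T,f)$ over $F$ has a finite state set $Q$, partial transition functions $\Delta_i$ mapping an $i$-tuple of states (unordered, as the children of a node are) and a label to a state, $\mathcal T:Q\to2^{PV\cup Y}$ and $f:Q\to F$. A run on $t$ is a map $\rho$ from nodes to states such that at each node $u$ with label $(S,y)$ and children $u_1,\dots,u_i$: $\Delta_i(\rho(u_1),\dots,\rho(u_i),(S,y))=\rho(u)$; if $u$ is a leaf, $\mathcal T(\rho(u))\cap PV\neq\emptyset$; if $u$ is not a leaf, $S\cap\mathcal T(\rho(u_j))=\emptyset$ and $y\notin\mathcal T(\rho(u_j))$ for all $j$, and $\mathcal T(\rho(u))=S\cup(\{y\}\cap Y)\cup\bigcup_j\mathcal T(\rho(u_j))$; and $\mathcal T(\rho(dirty))=PV\cup Y$. Let $L_f(\mathcal A)$ be the set of formula trees $(t,\varphi)$ such that $\mathcal A$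 has a run $\rho$ on $t$ with $f(\rho(dirty))=\varphi$. Let $\gamma(\mathcal A)$ be the set of heaps $H$ such that for each valuation tree of $H$, with symbolic tree $t$, there is a run $\rho$ on $t$ for which $f(\rho(dirty))$ holds of the data values. *Statements and $F^\natural$.* The statements are $p:=\mathtt{nil}$, $p:=q$, $p:=q\to\mathtt{next}$, $\mathtt{new}\ p$ (with $p\neq\mathtt{nil}$ in these four), $p\to\mathtt{next}:=\mathtt{nil}$, $p\to\mathtt{next}:=q$, $p\to\mathtt{data}:=e$, $\mathtt{assume}\ \psi_{struct}$, $\mathtt{assume}\ \psi_{data}$, where $e$ and $\psi_{data}$ are functions of the data at the pointer variables and $\psi_{struct}$ is a Boolean combination of $p=q$, $p\to\mathtt{next}=q$, $p\to^*\mathtt{next}=q$. They have their usual effect on heaps; $\mathtt{new}\ p$ makes $p$ point to a fresh location with arbitrary data whose $\mathtt{next}$ is $dirty$; in $q\to\mathtt{next}$ on the right, and in the assignments to $p\to\mathtt{next}$ and $p\to\mathtt{data}$, dereferencing a variable located at $dirty$ or at the location of $\mathtt{nil}$ is an error; locations no longer reachable from pointer variables disappear. For a set $C$ of heaps, $F^\natural_s(C)$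 is the set of heaps reached from some $H\in C$ by executing $s$; executions that fail with a memory error or would make $\mathtt{next}$ cyclic yield no heap. *$F_f^\sharp$.* $update(t,s,t')$ means that $s$ transforms the pointer structure of $t$ into that of $t'$ while all variables of $Y$ keep their locations; $update(t,\mathtt{new}^y p,t')$ means the same for $s=\mathtt{new}\ p$, except that $y$ (if $y\ne -$) is at the new location in $t'$ (and anywhere in $t$). $label(t,p)$ is the set of all variables in $PV\cup Y$ at the node of $p$. For a set $L$ of formula trees, $F^\sharp_f(L)$ is the set of all $(t',\varphi')$ such that, by the form of $s$ (empty joins being false): - $p:=\mathtt{nil}$: $\varphi'=\bigsqcup\{\exists d.\varphi[p\to\mathtt{data}/d]\mid(t,\varphi)\in L,\ update(t,s,t')\}$; - $p:=q$: $\varphi'=(p\to\mathtt{data}=q\to\mathtt{data})\sqcap\bigsqcup\{\exists d.\varphi[p\to\mathtt{data}/d]\mid(t,\varphi)\in L,\ update(t,s,t')\}$; - $p:=q\to\mathtt{next}$: $\varphi'=\bigsqcup\{\exists d.\varphi[p\to\mathtt{data}/d]\mid(t,\varphi)\in L,\ update(t,s,t')\}\sqcap\bigsqcap\{p\to\mathtt{data}=v\to\mathtt{data}\mid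 v\in label(t',p)\}$; - $p\to\mathtt{next}:=\mathtt{nil}$ and $p\to\mathtt{next}:=q$: $\varphi'=\bigsqcup\{\varphi\mid(t,\varphi)\in L,\ update(t,s,t')\}$; - $p\to\mathtt{data}:=e$: for some $(t',\varphi)\in L$ and with $V=\{v_1,\dots,v_\ell\}=label(t',p)$, $\varphi'=\exists d.\big(\varphi\,\theta\wedge\bigwedge\{v\to\mathtt{data}=e\,\theta\mid v\in V\}\big)$, where $\theta$ is the substitution $[v_1\to\mathtt{data}/d,\dots,v_\ell\to\mathtt{data}/d]$; - $\mathtt{assume}\ \psi_{struct}$: $(t',\varphi')\in L$ and $t'\models\psi_{struct}$; - $\mathtt{assume}\ \psi_{data}$: $\varphi'=\varphi\sqcap\psi_{data}$ for some $(t',\varphi)\in L$; - $\mathtt{new}\ p$: with $y\in Y\cup\{-\}$ the universal label of the node of $p$ in $t'$, $\varphi'=(y\to\mathtt{data}=p\to\mathtt{data})\sqcap\bigsqcup\{\exists d_1d_2.\varphi[p\to\mathtt{data}/d_1,y\to\mathtt{data}/d_2]\mid(t,\varphi)\in L,\ update(t,\mathtt{new}^y p,t')\}$, where the parts mentioning $y\to\mathtt{data}$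 are omitted if $y=-$. $F^\sharp_s(\mathcal A)$ is a QSDA $\mathcal A'$ with the least number of states such that $L_f(\mathcal A')=F^\sharp_f(L_f(\mathcal A))$. **Theorem (soundness of $F^\sharp$).** For every statement $s$ and every QSDA $\mathcal A$, such an $\mathcal A'=F^\sharp_s(\mathcal A)$ exists, and every such $\mathcal A'$ satisfies $F^\natural_s(\gamma(\mathcal A))\subseteq\gamma(\mathcal A')$, where, if $s$ is $\mathtt{new}\ p$, only those heaps $H\in\gamma(\mathcal A)$ are considered that have at least $|Y|$ locations (all of them if $|Y|\le2$), i.e. that have a valuation tree. -/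

import Mathlib

/-- Location `dirty` (un-allocated memory), the root of every heap skinny-tree. -/
abbrev dirty : ℕ := 0

/-- The pointer part `(Loc, next, pval)` of a program configuration; locations are drawn from `ℕ`.
Reversing the `next` edges, this is the tree underlying a heap skinny-tree: its root is `dirty`, and
node `u` carries the set of pointer variables pointing to it. Every location other than `dirty` has
a `next` edge (to `dirty` when the program has not set it), so the graph is one tree. -/
structure Shape (PV : Type*) (nil : PV) where
  loc : Finset ℕ
  next : ℕ → Option ℕ
  pval : PV → ℕ
  dirty_mem : dirty ∈ loc
  next_dirty : next dirty = none
  next_outside : ∀ u, u ∉ loc → next u = none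
  next_mem : ∀ u v, next u = some v → v ∈ loc
  next_defined : ∀ u ∈ loc, u ≠ dirty → ∃ v, next u = some v
  acyclic : ∀ u, ¬ Relation.TransGen (fun a b => next a = some b) u u
  pval_mem : ∀ p, pval p ∈ loc
  reachable : ∀ u ∈ loc, ∃ p, Relation.ReflTransGen (fun a b => next a = some b) (pval p) u
  next_nil : next (pval nil) = some dirty

/-- A program configuration (program counter omitted, no data variables), identified with its heap
skinny-tree. The value of `data` outside `loc` is irrelevant. -/
structure Heap (PV : Type*) (nil : PV) (D : Type*) where
  shape : Shape PV nil
  data : ℕ → D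

/-- A symbolic tree: a heap skinny-tree without data, in which every universal variable labels
exactly one node and every node is labelled by at most one universal variable. -/
structure SymTree (PV : Type*) (nil : PV) (Y : Type*) where
  shape : Shape PV nil
  val : Y → ℕ
  val_mem : ∀ y, val y ∈ shape.loc
  val_injective : Function.Injective val

namespace Shape

variable {PV : Type*} {nil : PV}

/-- Children of `u` in the tree: the locations whose `next` is `u`. -/
def children (σ : Shape PV nil) (u : ℕ) : Finset ℕ := σ.loc.filter (fun v => σ.next v = some u)

/-- Set of pointer variables labelling the node `u`. -/
def ptrLabel (σ : Shape PV nil) (u : ℕ) : Set PV := {p | σ.pval p = u}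

end Shape

namespace SymTree

variable {PV : Type*} {nil : PV} {Y : Type*}

/-- The node labelled by a pointer or universal variable. -/
def pos (t : SymTree PV nil Y) : PV ⊕ Y → ℕ := Sum.elim t.shape.pval t.val

open Classical in
/-- The universal variable labelling the node `u`; `none` is the symbol `-`. -/
noncomputable def univLabel (t : SymTree PV nil Y) (u : ℕ) : Option Y :=
  if h : ∃ y, t.val y = u then some h.choose else none

/-- `label(t, p)`: all variables labelling the same node as the pointer variable `p`. -/
def label (t : SymTree PV nil Y) (p : PV) : Set (PV ⊕ Y) := {x | t.pos x = t.shape.pval p}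

end SymTree

/-- Substitute the value `d` for the data of all variables in `S`. -/
noncomputable def substData {V D : Type*} (r : V → D) (S : Set V) (d : D) : V → D :=
  open Classical in fun x => if x ∈ S then d else r x

/-- A lattice `F` of data formulas about the data values of the variables `V`: bottom and top are
false and true, the order implies logical implication, the meet is conjunction, distinct formulas
are inequivalent, equalities between data values are formulas, and the formulas are closed under
`φ ↦ ∃ d. φ[x → data / d]`. -/
structure FormulaDomain (V D F : Type*) [Lattice F] [BoundedOrder F] where
  Sat : F → (V → D) → Prop
  sat_top : ∀ r, Sat ⊤ r
  not_sat_bot : ∀ r, ¬ Sat ⊥ r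
  sat_of_le : ∀ φ ψ, φ ≤ ψ → ∀ r, Sat φ r → Sat ψ r
  sat_inf : ∀ φ ψ r, Sat φ r → Sat ψ r → Sat (φ ⊓ ψ) r
  inequivalent : ∀ φ ψ, (∀ r, Sat φ r ↔ Sat ψ r) → φ = ψ
  exists_eq : ∀ x y : V, ∃ ψ, ∀ r, Sat ψ r ↔ r x = r y
  exists_ex : ∀ (φ : F) (x : V), ∃ ψ, ∀ r, Sat ψ r ↔ ∃ d, Sat φ (substData r {x} d)

namespace FormulaDomain

variable {PV Y V D F : Type*} [Lattice F] [BoundedOrder F]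

/-- `ψ` is the formula `x → data = y → data`. -/
def IsEq (𝓕 : FormulaDomain V D F) (x y : V) (ψ : F) : Prop :=
  ∀ r, 𝓕.Sat ψ r ↔ r x = r y

/-- `ψ` is the formula `∃ d. φ[x → data / d]`. -/
def IsEx (𝓕 : FormulaDomain V D F) (x : V) (φ ψ : F) : Prop :=
  ∀ r, 𝓕.Sat ψ r ↔ ∃ d, 𝓕.Sat φ (substData r {x} d)

/-- `ψ` is the formula `∃ d. (φ[S → data / d] ∧ ⋀ {v → data = e[S → data / d] | v ∈ S})`, the
strongest post-condition of `φ` for storing the value of `e` in the location of the variables `S`;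
the substitution in `e` says that `e` is evaluated before the store. -/
def IsStore (𝓕 : FormulaDomain (PV ⊕ Y) D F) (S : Set (PV ⊕ Y)) (e : (PV → D) → D)
    (φ ψ : F) : Prop :=
  ∀ r, 𝓕.Sat ψ r ↔ ∃ d, 𝓕.Sat φ (substData r S d) ∧
    ∀ v ∈ S, r v = e (fun p => substData r S d (Sum.inl p))

/-- `ψ` is the data predicate `P` about the data of the pointer variables. -/
def IsPred (𝓕 : FormulaDomain (PV ⊕ Y) D F) (P : (PV → D) → Prop) (ψ : F) : Prop :=
  ∀ r, 𝓕.Sat ψ r ↔ P (fun p => r (Sum.inl p))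

end FormulaDomain

/-- Structural predicates of the programming language. -/
inductive StructPred (PV : Type*)
  | eq (p q : PV)
  | nextEq (p q : PV)
  | reach (p q : PV)
  | not (ψ : StructPred PV)
  | and (ψ₁ ψ₂ : StructPred PV)
  | or (ψ₁ ψ₂ : StructPred PV)

/-- Truth of a structural predicate in a heap. -/
def StructPred.Holds {PV : Type*} {nil : PV} (σ : Shape PV nil) : StructPred PV → Prop
  | .eq p q => σ.pval p = σ.pval q
  | .nextEq p q => σ.next (σ.pval p) = some (σ.pval q)
  | .reach p q => Relation.ReflTransGen (fun a b => σ.next a = some b) (σ.pval p) (σ.pval q)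
  | .not ψ => ¬ ψ.Holds σ
  | .and ψ₁ ψ₂ => ψ₁.Holds σ ∧ ψ₂.Holds σ
  | .or ψ₁ ψ₂ => ψ₁.Holds σ ∨ ψ₂.Holds σ

/-- Primitive statements. Data expressions and data predicates are identified with the functions of
the data at the pointer variables that they denote; the variable `nil` is never assigned. -/
inductive Stmt (PV : Type*) (nil : PV) (D : Type*)
  | assignNil (p : PV) (hp : p ≠ nil)
  | assign (p q : PV) (hp : p ≠ nil)
  | assignNext (p q : PV) (hp : p ≠ nil)
  | setNextNil (p : PV)
  | setNext (p q : PV)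
  | setData (p : PV) (e : (PV → D) → D)
  | assumeStruct (ψ : StructPred PV)
  | assumeData (ψ : (PV → D) → Prop)
  | new (p : PV) (hp : p ≠ nil)

namespace Stmt

variable {PV Y D F : Type*} {nil : PV}

/-- The statement allocates a location. -/
def Allocates : Stmt PV nil D → Prop
  | .new _ _ => True
  | _ => False

/-- The formulas that the abstract transformer forms from the data expression or data predicate of
the statement belong to `F`. -/
def Expressible [Lattice F] [BoundedOrder F] (𝓕 : FormulaDomain (PV ⊕ Y) D F) :
    Stmt PV nil D → Prop
  | .setData p e => ∀ (S : Set (PV ⊕ Y)) (φ : F), Sum.inl p ∈ S → ∃ ψ, 𝓕.IsStore S e φ ψ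
  | .assumeData ψ => ∃ c, 𝓕.IsPred ψ c
  | _ => True

end Stmt

section Concrete

variable {PV D : Type*} {nil : PV}

/-- `σ'` results from the edges `nx` and the pointers of `σ'` when the locations not reachable from
a pointer variable disappear. -/
def Shape.Collects (nx : ℕ → Option ℕ) (σ' : Shape PV nil) : Prop :=
  (∀ u, u ∈ σ'.loc ↔
    ∃ p, Relation.ReflTransGen (fun a b => nx a = some b) (σ'.pval p) u) ∧
  ∀ u ∈ σ'.loc, σ'.next u = nx u

/-- Dereferencing `p` is no memory error. -/
def Shape.Derefs (σ : Shape PV nil) (p : PV) : Prop :=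
  σ.pval p ≠ dirty ∧ σ.pval p ≠ σ.pval nil

/-- Effect of a statement on the pointer structure. Executions that lead to a memory error or to a
cyclic heap have no successor. -/
def ShapeStep : Stmt PV nil D → Shape PV nil → Shape PV nil → Prop
  | .assignNil p _, σ, σ' =>
      σ'.pval p = σ.pval nil ∧ (∀ q, q ≠ p → σ'.pval q = σ.pval q) ∧ σ'.Collects σ.next
  | .assign p q _, σ, σ' =>
      σ'.pval p = σ.pval q ∧ (∀ q, q ≠ p → σ'.pval q = σ.pval q) ∧ σ'.Collects σ.next
  | .assignNext p q _, σ, σ' =>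
      σ.Derefs q ∧ σ.next (σ.pval q) = some (σ'.pval p) ∧
      (∀ q, q ≠ p → σ'.pval q = σ.pval q) ∧ σ'.Collects σ.next
  | .setNextNil p, σ, σ' =>
      σ.Derefs p ∧ σ'.pval = σ.pval ∧
      σ'.Collects (Function.update σ.next (σ.pval p) (some (σ.pval nil)))
  | .setNext p q, σ, σ' =>
      σ.Derefs p ∧ σ'.pval = σ.pval ∧
      σ'.Collects (Function.update σ.next (σ.pval p) (some (σ.pval q)))
  | .setData p _, σ, σ' => σ.Derefs p ∧ σ' = σ
  | .assumeStruct ψ, σ, σ' => ψ.Holds σ ∧ σ' = σ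
  | .assumeData _, σ, σ' => σ' = σ
  | .new p _, σ, σ' =>
      σ'.pval p ∉ σ.loc ∧ (∀ q, q ≠ p → σ'.pval q = σ.pval q) ∧
      σ'.Collects (Function.update σ.next (σ'.pval p) (some dirty))

/-- Data values of the pointer variables. -/
def Heap.ptrData (H : Heap PV nil D) : PV → D := fun p => H.data (H.shape.pval p)

/-- Effect of a statement on the data. A new location holds an arbitrary value. -/
def DataStep : Stmt PV nil D → Heap PV nil D → Heap PV nil D → Prop
  | .setData p e, H, H' =>
      H'.data (H.shape.pval p) = e H.ptrData ∧
      ∀ u ∈ H.shape.loc, u ≠ H.shape.pval p → H'.data u = H.data u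
  | .assumeData ψ, H, H' => ψ H.ptrData ∧ ∀ u ∈ H.shape.loc, H'.data u = H.data u
  | _, H, H' => ∀ u ∈ H'.shape.loc, u ∈ H.shape.loc → H'.data u = H.data u

/-- The concrete transformer `F♮` of a statement: the set of its successor heaps. -/
def concretePost (s : Stmt PV nil D) (C : Set (Heap PV nil D)) : Set (Heap PV nil D) :=
  {H' | ∃ H ∈ C, ShapeStep s H.shape H'.shape ∧ DataStep s H H'}

end Concrete

/-- Quantified skinny-tree data automata, with `n` states. `Δ i` reads the states of the `i` children
of a node, as an unordered tuple because the children of a heap location are not ordered, and the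
label of the node; it may be undefined. -/
structure QSDA (PV Y F : Type*) [Fintype PV] where
  n : ℕ
  Δ : (i : Fin (Fintype.card PV + 1)) → Sym (Fin n) i → Set PV × Option Y → Option (Fin n)
  typ : Fin n → Set (PV ⊕ Y)
  f : Fin n → F

namespace QSDA

variable {PV Y D F : Type*} {nil : PV} [Fintype PV]

/-- The state map `ρ` is a run of the automaton on the symbolic tree `t`. -/
structure IsRun (A : QSDA PV Y F) (t : SymTree PV nil Y) (ρ : ℕ → Fin A.n) : Prop where
  trans : ∀ u ∈ t.shape.loc, ∃ (i : Fin (Fintype.card PV + 1)) (m : Sym (Fin A.n) i),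
    (m : Multiset (Fin A.n)) = (t.shape.children u).val.map ρ ∧
    A.Δ i m (t.shape.ptrLabel u, t.univLabel u) = some (ρ u)
  leaf : ∀ u ∈ t.shape.loc, t.shape.children u = ∅ → ∃ p, Sum.inl p ∈ A.typ (ρ u)
  disjoint_ptr : ∀ u ∈ t.shape.loc, ∀ v ∈ t.shape.children u,
    ∀ p ∈ t.shape.ptrLabel u, Sum.inl p ∉ A.typ (ρ v)
  disjoint_univ : ∀ u ∈ t.shape.loc, ∀ v ∈ t.shape.children u,
    ∀ y, t.univLabel u = some y → Sum.inr y ∉ A.typ (ρ v)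
  typ_internal : ∀ u ∈ t.shape.loc, t.shape.children u ≠ ∅ →
    A.typ (ρ u) = Sum.inl '' t.shape.ptrLabel u ∪ Sum.inr '' {y | t.univLabel u = some y} ∪
      ⋃ v ∈ t.shape.children u, A.typ (ρ v)
  typ_root : A.typ (ρ dirty) = Set.univ

/-- `L_f(A)`: the formula trees accepted by `A`. -/
def formulaLang (nil : PV) (A : QSDA PV Y F) : Set (SymTree PV nil Y × F) :=
  {x | ∃ ρ, A.IsRun x.1 ρ ∧ A.f (ρ dirty) = x.2}

/-- `A` recognizes the valuation tree consisting of the symbolic tree `t` and the data values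
`data` of its nodes. -/
def Recognizes [Lattice F] [BoundedOrder F] (𝓕 : FormulaDomain (PV ⊕ Y) D F) (A : QSDA PV Y F)
    (t : SymTree PV nil Y) (data : ℕ → D) : Prop :=
  ∃ ρ, A.IsRun t ρ ∧ 𝓕.Sat (A.f (ρ dirty)) (fun x => data (t.pos x))

/-- The concretization `γ(A) = L(A)`: the heap skinny-trees all of whose valuation trees are
recognized by `A`. -/
def lang [Lattice F] [BoundedOrder F] (nil : PV) (𝓕 : FormulaDomain (PV ⊕ Y) D F)
    (A : QSDA PV Y F) : Set (Heap PV nil D) :=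
  {H | ∀ t : SymTree PV nil Y, t.shape = H.shape → A.Recognizes 𝓕 t H.data}

end QSDA

section Abstract

variable {PV Y D F : Type*} {nil : PV}

/-- `update(t, s, t')`: executing `s` updates the symbolic tree `t` to `t'`, the universal variables
staying where they are. -/
def Update (t : SymTree PV nil Y) (s : Stmt PV nil D) (t' : SymTree PV nil Y) : Prop :=
  ShapeStep s t.shape t'.shape ∧ ∀ y, t'.val y = t.val y

/-- `update(t, new^y p, t')`: the allocation updates `t` to `t'`, and `y` is the universal variable
that labels the new node of `t'` (none of them does if `y` is `none`). -/
def UpdateNew (t : SymTree PV nil Y) (s : Stmt PV nil D) (p : PV) (y : Option Y)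
    (t' : SymTree PV nil Y) : Prop :=
  ShapeStep s t.shape t'.shape ∧ (∀ z, y = some z → t'.val z = t'.shape.pval p) ∧
    ∀ z, y ≠ some z → t'.val z = t.val z

variable [Lattice F] [BoundedOrder F]

/-- The abstract transformer `F_f♯` on languages `L` of formula trees. Joins and meets of sets of
formulas are least upper bounds and greatest lower bounds in the lattice `F`. -/
def formulaPost (𝓕 : FormulaDomain (PV ⊕ Y) D F) (s : Stmt PV nil D)
    (L : Set (SymTree PV nil Y × F)) : Set (SymTree PV nil Y × F) :=
  match s with
  | .assignNil p _ => {x | IsLUB {ψ | ∃ t φ, (t, φ) ∈ L ∧ Update t s x.1 ∧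
      𝓕.IsEx (Sum.inl p) φ ψ} x.2}
  | .assign p q _ => {x | ∃ χ ε, IsLUB {ψ | ∃ t φ, (t, φ) ∈ L ∧ Update t s x.1 ∧
      𝓕.IsEx (Sum.inl p) φ ψ} χ ∧ 𝓕.IsEq (Sum.inl p) (Sum.inl q) ε ∧ x.2 = ε ⊓ χ}
  | .assignNext p _ _ => {x | ∃ χ, IsLUB {ψ | ∃ t φ, (t, φ) ∈ L ∧ Update t s x.1 ∧
      𝓕.IsEx (Sum.inl p) φ ψ} χ ∧
      IsGLB (insert χ {ε | ∃ v ∈ x.1.label p, 𝓕.IsEq (Sum.inl p) v ε}) x.2}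
  | .setNextNil _ => {x | IsLUB {φ | ∃ t, (t, φ) ∈ L ∧ Update t s x.1} x.2}
  | .setNext _ _ => {x | IsLUB {φ | ∃ t, (t, φ) ∈ L ∧ Update t s x.1} x.2}
  | .setData p e => {x | ∃ φ, (x.1, φ) ∈ L ∧ 𝓕.IsStore (x.1.label p) e φ x.2}
  | .assumeStruct ψ => {x | x ∈ L ∧ ψ.Holds x.1.shape}
  | .assumeData ψ => {x | ∃ φ c, (x.1, φ) ∈ L ∧ 𝓕.IsPred ψ c ∧ x.2 = φ ⊓ c}
  | .new p _ => {x | match x.1.univLabel (x.1.shape.pval p) with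
      | none => IsLUB {ψ | ∃ t φ, (t, φ) ∈ L ∧ UpdateNew t s p none x.1 ∧
          𝓕.IsEx (Sum.inl p) φ ψ} x.2
      | some y => ∃ χ ε, IsLUB {ψ | ∃ t φ θ, (t, φ) ∈ L ∧ UpdateNew t s p (some y) x.1 ∧
          𝓕.IsEx (Sum.inl p) φ θ ∧ 𝓕.IsEx (Sum.inr y) θ ψ} χ ∧
          𝓕.IsEq (Sum.inr y) (Sum.inl p) ε ∧ x.2 = ε ⊓ χ}

/-- `A' = F♯(A)`: `A'` is a QSDA with the least number of states among those that accept the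
formula trees `F_f♯(L_f(A))`. -/
def IsAbstractPost [Fintype PV] (nil : PV) (𝓕 : FormulaDomain (PV ⊕ Y) D F) (s : Stmt PV nil D)
    (A A' : QSDA PV Y F) : Prop :=
  A'.formulaLang nil = formulaPost 𝓕 s (A.formulaLang nil) ∧
  ∀ B : QSDA PV Y F, B.formulaLang nil = formulaPost 𝓕 s (A.formulaLang nil) → A'.n ≤ B.n

end Abstract

/-!
The quantified automata are finite bottom-up automata on unordered trees, so the existence of the
abstract successor is a regularity statement: for each root state `q` of `A`, the symbolic trees
`t'` that have a predecessor `t` on which `A` ends in `q` must form a regular set. The output at `t'`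
is then a partial function of the finite set of these `q` and of the label of the assigned pointer,
because joins over predecessors are joins over the finitely many formulas `A.f q`, and because `A`,
being deterministic, has at most one formula for each tree.

Regularity is proved for labelled trees `LTree V`, in which neither reachability from pointer
variables nor injectivity of the labelling is required. `Regular` means recognizability by a
nondeterministic automaton, which the subset construction (`Regular.exists_det`) makes
deterministic; this gives the Boolean operations. Regular sets are closed under renaming variables
(`Regular.comap`), quantifying over the position of a variable (`Regular.image_comap_some`),
deleting unlabelled subtrees (`Regular.prune`), removing a leaf (`Regular.remove`) and redirecting
one edge (`Regular.reattach`). Each statement is a composition of these operations: the old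
positions that it overwrites become existentially quantified variables, the change of the edges is
undone by `Regular.remove` or `Regular.reattach`, and garbage collection is `Regular.prune`
(`SymTree.collects_iff_sub`). The results are `exists_regular_assign`, `exists_regular_setNext` and
`exists_regular_new`.

Conversely `exists_formulaLang_eq` turns a finite family of regular sets and a partial function from
its subsets to formulas into a quantified automaton. The type of a state is the set of variables in
the subtree of the node. The root is recognized as the only node with a child that carries `nil`, so
that the output can be made undefined by blocking the transition there.

For the soundness of the transformer, a valuation tree of a successor heap is pulled back to one of
the old heap, whose formula contributes to the join; the overwritten data values are the witnesses
of the existential quantifiers. For an allocation with a universal variable on the new location, that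
variable needs a free place in the old heap, which exists because there are at least `|Y|`
locations.
-/

/-! ### Rooted trees and their labellings -/

/-- A finite tree with root `dirty`, given by its parent map `next`. In contrast to `Shape`, no
location has to be reachable from a pointer variable. -/
structure RTree where
  loc : Finset ℕ
  next : ℕ → Option ℕ
  dirty_mem : dirty ∈ loc
  next_dirty : next dirty = none
  next_outside : ∀ u, u ∉ loc → next u = none
  next_mem : ∀ u v, next u = some v → v ∈ loc
  next_defined : ∀ u ∈ loc, u ≠ dirty → ∃ v, next u = some v
  acyclic : ∀ u, ¬ Relation.TransGen (fun a b => next a = some b) u u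

/-- A rooted tree in which every variable of `V` is placed on a node; several variables may share a
node. -/
@[ext]
structure LTree (V : Type*) extends RTree where
  pos : V → ℕ
  pos_mem : ∀ v, pos v ∈ loc

namespace RTree

/-- `T.Reach u v`: the node `v` is `u` or an ancestor of `u`. -/
def Reach (T : RTree) : ℕ → ℕ → Prop := Relation.ReflTransGen (fun a b => T.next a = some b)

/-- The nodes whose parent is `u`. -/
def children (T : RTree) (u : ℕ) : Finset ℕ := T.loc.filter (fun v => T.next v = some u)

variable (T : RTree)

theorem mem_loc_of_next {u v : ℕ} (h : T.next u = some v) : u ∈ T.loc := by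
  by_contra hu
  simp [T.next_outside u hu] at h

theorem mem_children {u v : ℕ} : v ∈ T.children u ↔ T.next v = some u := by
  simp only [children, Finset.mem_filter, and_iff_right_iff_imp]
  exact T.mem_loc_of_next

theorem reach_mem {u v : ℕ} (hu : u ∈ T.loc) (h : T.Reach u v) : v ∈ T.loc := by
  rcases Relation.ReflTransGen.cases_tail h with rfl | ⟨w, _, h⟩
  · exact hu
  · exact T.next_mem _ _ h

theorem reach_mem_left {u v : ℕ} (hv : v ∈ T.loc) (h : T.Reach u v) : u ∈ T.loc := by
  rcases Relation.ReflTransGen.cases_head h with rfl | ⟨w, h, _⟩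
  · exact hv
  · exact T.mem_loc_of_next h

theorem reach_total {a u v : ℕ} (hu : T.Reach a u) (hv : T.Reach a v) :
    T.Reach u v ∨ T.Reach v u :=
  Relation.ReflTransGen.total_of_right_unique
    (fun _ _ _ h h' => Option.some_injective _ (h.symm.trans h')) hu hv

open Classical in
/-- Induction from the leaves to the root. -/
theorem wf_down : WellFounded (fun a b => T.next a = some b) := by
  let d : ℕ → ℕ := fun u =>
    (T.loc.filter (Relation.TransGen (fun a b => T.next a = some b) · u)).card
  refine Subrelation.wf (r := fun a b => d a < d b) ?_ (measure d).wf
  intro a b h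
  refine Finset.card_lt_card (Finset.ssubset_iff_of_subset ?_ |>.2 ⟨a, ?_, ?_⟩)
  · intro c hc
    simp only [Finset.mem_filter] at hc ⊢
    exact ⟨hc.1, hc.2.tail h⟩
  · simp only [Finset.mem_filter]
    exact ⟨T.mem_loc_of_next h, .single h⟩
  · simp [T.acyclic a]

open Classical in
/-- The number of proper ancestors decreases along the edges. -/
theorem exists_height : ∃ h : ℕ → ℕ, ∀ u v, T.next u = some v → h v < h u := by
  refine ⟨fun u =>
    (T.loc.filter (Relation.TransGen (fun a b => T.next a = some b) u ·)).card, fun b a h => ?_⟩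
  refine Finset.card_lt_card (Finset.ssubset_iff_of_subset ?_ |>.2 ⟨a, ?_, ?_⟩)
  · intro c hc
    simp only [Finset.mem_filter] at hc ⊢
    exact ⟨hc.1, hc.2.head h⟩
  · simp only [Finset.mem_filter]
    exact ⟨T.next_mem _ _ h, .single h⟩
  · simp [T.acyclic a]

/-- Induction from the root to the leaves. -/
theorem wf_up : WellFounded (fun a b => T.next b = some a) := by
  obtain ⟨h, hh⟩ := T.exists_height
  exact Subrelation.wf (r := fun a b => h a < h b) (fun {a b} hab => hh b a hab) (measure h).wf

theorem induction_down {P : ℕ → Prop} (h : ∀ u, (∀ v, T.next v = some u → P v) → P u) (u : ℕ) :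
    P u := T.wf_down.induction u h

theorem induction_up {P : ℕ → Prop} (h₀ : P dirty)
    (h : ∀ u v, T.next v = some u → P u → P v) {u : ℕ} (hu : u ∈ T.loc) : P u := by
  induction u using T.wf_up.induction with
  | h u ih =>
    by_cases hd : u = dirty
    · exact hd ▸ h₀
    · obtain ⟨v, hv⟩ := T.next_defined u hu hd
      exact h _ _ hv (ih v hv (T.next_mem _ _ hv))

theorem reach_dirty {u : ℕ} (hu : u ∈ T.loc) : T.Reach u dirty :=
  T.induction_up (P := fun u => T.Reach u dirty) .refl (fun _ _ h h' => .head h h') hu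

theorem reach_iff {a u : ℕ} :
    T.Reach a u ↔ a = u ∨ ∃ v ∈ T.children u, T.Reach a v := by
  constructor
  · intro h
    rcases Relation.ReflTransGen.cases_tail h with h | ⟨w, h, h'⟩
    · exact .inl h.symm
    · exact .inr ⟨w, T.mem_children.2 h', h⟩
  · rintro (rfl | ⟨v, hv, h⟩)
    · exact .refl
    · exact .tail h (T.mem_children.1 hv)

/-- Two different children of a node have no common descendant. -/
theorem eq_of_reach_of_next {a u v w : ℕ} (hv : T.next v = some u) (hw : T.next w = some u)
    (hav : T.Reach a v) (haw : T.Reach a w) : v = w := by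
  have key : ∀ v w, T.next v = some u → T.next w = some u → T.Reach v w → v = w := by
    intro v w hv hw h
    rcases Relation.ReflTransGen.cases_head h with h | ⟨x, hx, h⟩
    · exact h
    · obtain rfl : x = u := Option.some_injective _ (hx.symm.trans hv)
      exact (T.acyclic x (Relation.TransGen.tail' h hw)).elim
  rcases T.reach_total hav haw with h | h
  · exact key _ _ hv hw h
  · exact (key _ _ hw hv h).symm

/-- Recursion from the leaves to the root. -/
theorem exists_bottomUp {α : Type*} (F : ℕ → Multiset α → α) :
    ∃ ρ : ℕ → α, ∀ u, ρ u = F u ((T.children u).val.map ρ) := by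
  refine ⟨T.wf_down.fix (fun u ih => F u ((T.children u).val.attach.map
    (fun v => ih v.1 (T.mem_children.1 v.2)))), fun u => ?_⟩
  rw [WellFounded.fix_eq]
  congr 1
  exact Multiset.attach_map_val' (T.children u).val (fun v => T.wf_down.fix _ v)

/-- Recursion from the root to the leaves. -/
theorem exists_topDown {α : Type*} (a : α) (F : ℕ → ℕ → α → α) :
    ∃ ρ : ℕ → α, ρ dirty = a ∧ ∀ u v, T.next v = some u → ρ v = F u v (ρ u) := by
  refine ⟨T.wf_up.fix (fun v ih => match h : T.next v with
    | none => a
    | some u => F u v (ih u h)), ?_, fun u v h => ?_⟩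
  · rw [WellFounded.fix_eq]
    split
    · rfl
    · rename_i h; simp [T.next_dirty] at h
  · rw [WellFounded.fix_eq]
    split
    · rename_i h'; simp [h'] at h
    · rename_i w h'
      obtain rfl : w = u := Option.some_injective _ (h'.symm.trans h)
      rfl

end RTree

namespace LTree

variable {V W S : Type*}

/-- The set of variables placed on the node `u`. -/
def label (G : LTree V) (u : ℕ) : Set V := {v | G.pos v = u}

/-- `ρ` is a run on `G` of the nondeterministic bottom-up tree automaton with the transition
relation `δ`, which relates the states of the children and the label of a node to its state. -/
def Run (G : LTree V) (δ : Multiset S → Set V → S → Prop) (ρ : ℕ → S) : Prop :=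
  ∀ u ∈ G.loc, δ ((G.children u).val.map ρ) (G.label u) (ρ u)

theorem mem_label {G : LTree V} {u : ℕ} {v : V} : v ∈ G.label u ↔ G.pos v = u := Iff.rfl

theorem Run.unique {G : LTree V} {δ : Multiset S → Set V → S → Prop} {ρ ρ' : ℕ → S}
    (h : G.Run δ ρ) (hδ : ∀ m l s s', δ m l s → δ m l s' → s = s') (h' : G.Run δ ρ') {u : ℕ}
    (hu : u ∈ G.loc) : ρ u = ρ' u := by
  revert hu
  induction u using G.induction_down with
  | h u ih =>
    refine fun hu => hδ _ _ _ _ (h u hu) ?_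
    convert h' u hu using 1
    refine Multiset.map_congr rfl fun v hv => ?_
    have hv := G.mem_children.1 hv
    exact ih v hv (G.mem_loc_of_next hv)

end LTree

/-! ### Recognizable tree languages -/

/-- A set of labelled trees is regular if a nondeterministic bottom-up automaton with finitely many
states recognizes it. The transition relation may depend on the multiset of the states of the
children in an arbitrary way. -/
def Regular {V : Type*} (L : Set (LTree V)) : Prop :=
  ∃ (n : ℕ) (δ : Multiset (Fin n) → Set V → Fin n → Prop) (acc : Set (Fin n)),
    ∀ G, G ∈ L ↔ ∃ ρ, G.Run δ ρ ∧ ρ dirty ∈ acc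

section

variable {V S : Type*}

theorem Regular.of_finite [Finite S] {L : Set (LTree V)}
    (δ : Multiset S → Set V → S → Prop) (acc : Set S)
    (h : ∀ G, G ∈ L ↔ ∃ ρ, G.Run δ ρ ∧ ρ dirty ∈ acc) : Regular L := by
  obtain ⟨n, ⟨e⟩⟩ := Finite.exists_equiv_fin S
  refine ⟨n, fun m l s => δ (m.map e.symm) l (e.symm s), e.symm ⁻¹' acc, fun G => ?_⟩
  rw [h]
  constructor
  · rintro ⟨ρ, hρ, ha⟩
    refine ⟨e ∘ ρ, fun u hu => ?_, by simpa using ha⟩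
    simpa [Multiset.map_map, Function.comp_def] using hρ u hu
  · rintro ⟨ρ, hρ, ha⟩
    refine ⟨e.symm ∘ ρ, fun u hu => ?_, by simpa using ha⟩
    simpa [Multiset.map_map, Function.comp_def] using hρ u hu

/-- A multiset with the same image as a family over `s` is itself a family over `s`, and the two
families correspond pointwise. -/
theorem exists_of_map_eq_map {α β : Type*} (s : Finset ℕ) (g : α → β) (τ : ℕ → β)
    (m : Multiset α) (h : m.map g = s.val.map τ) (hα : ∀ x, ∃ a, g a = τ x) :
    ∃ c : ℕ → α, m = s.val.map c ∧ ∀ v, g (c v) = τ v := by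
  classical
  choose c₀ hc₀ using hα
  induction s using Finset.induction_on generalizing m with
  | empty => exact ⟨c₀, by simpa using h, hc₀⟩
  | insert a s ha ih =>
    rw [Finset.insert_val_of_notMem ha, Multiset.map_cons] at h
    obtain ⟨x, hx, hxa, hm⟩ := (Multiset.map_eq_cons _ _ _ _).2 h
    obtain ⟨c, hc, hc'⟩ := ih _ hm
    refine ⟨Function.update c a x, ?_, fun v => ?_⟩
    · rw [Finset.insert_val_of_notMem ha, Multiset.map_cons, Function.update_self,
        ← Multiset.cons_erase hx, hc]
      congr 1
      refine Multiset.map_congr rfl fun v hv => ?_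
      rw [Function.update_of_ne]
      rintro rfl
      exact ha hv
    · by_cases hv : v = a
      · subst hv; simpa using hxa
      · simpa [hv] using hc' v

/-- Subset construction: a regular set is recognized by a deterministic, total automaton. -/
theorem Regular.exists_det {L : Set (LTree V)} (h : Regular L) :
    ∃ (S : Type) (_ : Finite S) (step : Multiset S → Set V → S) (acc : Set S),
      ∀ (G : LTree V) (ρ : ℕ → S),
        (∀ u ∈ G.loc, ρ u = step ((G.children u).val.map ρ) (G.label u)) →
          (G ∈ L ↔ ρ dirty ∈ acc) := by
  obtain ⟨n, δ, acc, h⟩ := h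
  refine ⟨Set (Fin n), inferInstance, fun M l => {s | ∃ m : Multiset (Fin n × Set (Fin n)),
    (∀ x ∈ m, x.1 ∈ x.2) ∧ m.map Prod.snd = M ∧ δ (m.map Prod.fst) l s},
    {X | ∃ s ∈ acc, s ∈ X}, fun G τ hτ => ?_⟩
  rw [h]
  constructor
  · rintro ⟨ρ, hρ, ha⟩
    refine ⟨ρ dirty, ha, ?_⟩
    suffices ∀ u, u ∈ G.loc → ρ u ∈ τ u from this _ G.dirty_mem
    refine G.induction_down fun u ih hu => ?_
    rw [hτ u hu]
    refine ⟨(G.children u).val.map (fun v => (ρ v, τ v)), ?_, ?_, ?_⟩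
    · intro x hx
      obtain ⟨v, hv, rfl⟩ := Multiset.mem_map.1 hx
      have hv := G.mem_children.1 hv
      exact ih v hv (G.mem_loc_of_next hv)
    · simp [Multiset.map_map]
    · simpa [Multiset.map_map] using hρ u hu
  · rintro ⟨s₀, hs₀, hd⟩
    have key : ∀ u s, ∃ c : ℕ → Fin n, u ∈ G.loc → s ∈ τ u →
        (∀ v ∈ G.children u, c v ∈ τ v) ∧ δ ((G.children u).val.map c) (G.label u) s := by
      intro u s
      by_cases hu : u ∈ G.loc ∧ s ∈ τ u
      · obtain ⟨hu, hs⟩ := hu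
        rw [hτ u hu] at hs
        obtain ⟨m, hm, hm', hδ⟩ := hs
        obtain ⟨c, hc, hc'⟩ := exists_of_map_eq_map (G.children u) Prod.snd τ m hm'
          (fun x => ⟨(s, τ x), rfl⟩)
        refine ⟨fun v => (c v).1, fun _ _ => ⟨fun v hv => ?_, ?_⟩⟩
        · rw [← hc' v]
          exact hm _ (hc ▸ Multiset.mem_map_of_mem _ hv)
        · simpa [hc, Multiset.map_map, Function.comp_def] using hδ
      · exact ⟨fun _ => s, fun h h' => (hu ⟨h, h'⟩).elim⟩
    choose c hc using key
    obtain ⟨ρ, hρ₀, hρ⟩ := G.exists_topDown s₀ (fun u v s => c u s v)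
    have hmem : ∀ u ∈ G.loc, ρ u ∈ τ u := fun u hu =>
      G.induction_up (P := fun u => ρ u ∈ τ u) (hρ₀ ▸ hd) (fun u v h ih => by
        rw [hρ u v h]
        exact (hc u _ (G.next_mem _ _ h) ih).1 v (G.mem_children.2 h)) hu
    refine ⟨ρ, fun u hu => ?_, hρ₀ ▸ hs₀⟩
    convert (hc u _ hu (hmem u hu)).2 using 1
    exact Multiset.map_congr rfl fun v hv => hρ u v (G.mem_children.1 hv)

/-- Finitely many regular sets are decided by one deterministic automaton. -/
theorem exists_det_family {ι : Type*} [Finite ι] (L : ι → Set (LTree V))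
    (h : ∀ i, Regular (L i)) :
    ∃ (S : ι → Type) (_ : Finite (∀ i, S i)) (step : Multiset (∀ i, S i) → Set V → ∀ i, S i)
      (out : (∀ i, S i) → Set ι), ∀ (G : LTree V) (ρ : ℕ → ∀ i, S i),
        (∀ u ∈ G.loc, ρ u = step ((G.children u).val.map ρ) (G.label u)) →
          {i | G ∈ L i} = out (ρ dirty) := by
  choose S hS step acc hL using fun i => (h i).exists_det
  refine ⟨S, inferInstance, fun M l i => step i (M.map (fun s => s i)) l,
    fun s => {i | s i ∈ acc i}, fun G ρ hρ => ?_⟩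
  ext i
  refine hL i G (fun u => ρ u i) fun u hu => ?_
  simpa [Multiset.map_map, Function.comp_def] using congrFun (hρ u hu) i

/-- A set recognized by a deterministic, total automaton is regular. -/
theorem Regular.of_det [Finite S] {L : Set (LTree V)} (step : Multiset S → Set V → S)
    (acc : Set S) (h : ∀ (G : LTree V) (ρ : ℕ → S),
      (∀ u ∈ G.loc, ρ u = step ((G.children u).val.map ρ) (G.label u)) →
        (G ∈ L ↔ ρ dirty ∈ acc)) : Regular L := by
  refine .of_finite (fun m l s => s = step m l) acc fun G => ⟨fun hG => ?_, ?_⟩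
  · obtain ⟨ρ, hρ⟩ := G.exists_bottomUp (fun u m => step m (G.label u))
    exact ⟨ρ, fun u _ => hρ u, (h G ρ fun u _ => hρ u).1 hG⟩
  · rintro ⟨ρ, hρ, ha⟩
    exact (h G ρ hρ).2 ha

/-- Every Boolean combination of finitely many regular sets is regular. -/
theorem Regular.comb {ι : Type*} [Finite ι] {L : ι → Set (LTree V)} (h : ∀ i, Regular (L i))
    (Φ : Set ι → Prop) : Regular {G | Φ {i | G ∈ L i}} := by
  obtain ⟨S, _, step, out, hL⟩ := exists_det_family L h
  refine .of_det step {s | Φ (out s)} fun G ρ hρ => ?_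
  change Φ _ ↔ Φ _
  rw [hL G ρ hρ]

theorem Regular.compl {L : Set (LTree V)} (h : Regular L) : Regular Lᶜ := by
  have := Regular.comb (ι := Unit) (L := fun _ => L) (fun _ => h) (fun X => () ∉ X)
  exact this

theorem Regular.inter {L M : Set (LTree V)} (hL : Regular L) (hM : Regular M) :
    Regular (L ∩ M) := by
  have := Regular.comb (ι := Bool) (L := fun b => bif b then L else M)
    (fun b => by cases b <;> assumption) (fun X => true ∈ X ∧ false ∈ X)
  exact this

theorem Regular.union {L M : Set (LTree V)} (hL : Regular L) (hM : Regular M) :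
    Regular (L ∪ M) := by
  have := Regular.comb (ι := Bool) (L := fun b => bif b then L else M)
    (fun b => by cases b <;> assumption) (fun X => true ∈ X ∨ false ∈ X)
  exact this

end

/-! ### Elementary regular sets -/

section

variable {V W S : Type*}

theorem regular_local [Finite V] (P : Set V → Multiset (Set V) → Prop) :
    Regular {G : LTree V |
      ∀ u ∈ G.loc, P (G.label u) ((G.children u).val.map G.label)} := by
  refine .of_finite (S := Set V) (fun m l s => s = l ∧ P l m) Set.univ fun G => ?_
  constructor
  · exact fun h => ⟨G.label, fun u hu => ⟨rfl, h u hu⟩, trivial⟩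
  · rintro ⟨ρ, hρ, -⟩ u hu
    convert (hρ u hu).2 using 1
    refine Multiset.map_congr rfl fun v hv => ((hρ v ?_).1).symm
    exact G.mem_loc_of_next (G.mem_children.1 hv)

theorem regular_root [Finite V] (P : Set V → Multiset (Set V) → Prop) :
    Regular {G : LTree V | P (G.label dirty) ((G.children dirty).val.map G.label)} := by
  refine .of_finite (S := Set V × Prop) (fun m l s => s.1 = l ∧ (s.2 ↔ P l (m.map Prod.fst)))
    {s | s.2} fun G => ?_
  constructor
  · intro h
    refine ⟨fun u => (G.label u, P (G.label u) ((G.children u).val.map G.label)),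
      fun u hu => ⟨rfl, ?_⟩, h⟩
    simp [Multiset.map_map]
  · rintro ⟨ρ, hρ, h⟩
    have := (hρ dirty G.dirty_mem).2.1 h
    rw [Multiset.map_map] at this
    change P _ _
    convert this using 1
    refine Multiset.map_congr rfl fun v hv => ((hρ v ?_).1).symm
    exact G.mem_loc_of_next (G.mem_children.1 hv)

theorem regular_univ : Regular (Set.univ : Set (LTree V)) :=
  .of_finite (S := Unit) (fun _ _ _ => True) Set.univ fun _ =>
    ⟨fun _ => ⟨fun _ => (), fun _ _ => trivial, trivial⟩, fun _ => trivial⟩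

theorem regular_reach (a b : V) : Regular {G : LTree V | G.Reach (G.pos a) (G.pos b)} := by
  refine .of_finite (S := Prop) (fun m l s => (s ↔ a ∈ l ∨ ∃ x ∈ m, x) ∧ (b ∈ l → s))
    Set.univ fun G => ?_
  constructor
  · intro h
    refine ⟨fun u => G.Reach (G.pos a) u, fun u hu => ⟨?_, ?_⟩, trivial⟩
    · change G.Reach _ u ↔ _
      rw [G.reach_iff]
      refine or_congr Iff.rfl ⟨fun ⟨v, hv, h⟩ => ⟨_, Multiset.mem_map_of_mem _ hv, h⟩, ?_⟩
      rintro ⟨_, hx, h⟩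
      obtain ⟨v, hv, rfl⟩ := Multiset.mem_map.1 hx
      exact ⟨v, hv, h⟩
    · rintro rfl
      exact h
  · rintro ⟨ρ, hρ, -⟩
    have key : ∀ u, ρ u → u ∈ G.loc → G.Reach (G.pos a) u := by
      refine fun u => G.induction_down (P := fun u => ρ u → u ∈ G.loc → G.Reach (G.pos a) u)
        (fun u ih h hu => ?_) u
      rcases (hρ u hu).1.1 h with h | ⟨x, hx, h⟩
      · exact h ▸ .refl
      · obtain ⟨v, hv, rfl⟩ := Multiset.mem_map.1 hx
        have hv := G.mem_children.1 hv
        exact (ih v hv h (G.mem_loc_of_next hv)).tail hv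
    exact key _ ((hρ _ (G.pos_mem b)).2 rfl) (G.pos_mem b)

theorem regular_eq [Finite V] (a b : V) : Regular {G : LTree V | G.pos a = G.pos b} := by
  convert regular_local (V := V) (fun l _ => a ∈ l → b ∈ l) using 1
  ext G
  simp only [Set.mem_ofPred_eq, LTree.mem_label]
  exact ⟨fun h u _ hu => h ▸ hu, fun h => (h _ (G.pos_mem a) rfl).symm⟩

theorem regular_next [Finite V] (a b : V) :
    Regular {G : LTree V | G.next (G.pos a) = some (G.pos b)} := by
  convert regular_local (V := V) (fun l m => b ∈ l → ∃ c ∈ m, a ∈ c) using 1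
  ext G
  simp only [Set.mem_ofPred_eq, LTree.mem_label, Multiset.mem_map, Finset.mem_val,
    RTree.mem_children, exists_exists_and_eq_and]
  constructor
  · rintro h u _ rfl
    exact ⟨_, h, rfl⟩
  · intro h
    obtain ⟨v, hv, rfl⟩ := h _ (G.pos_mem b) rfl
    exact hv

theorem regular_dirty [Finite V] (a : V) : Regular {G : LTree V | G.pos a = dirty} :=
  regular_root (fun l _ => a ∈ l)

theorem regular_next_dirty [Finite V] (a : V) :
    Regular {G : LTree V | G.next (G.pos a) = some dirty} := by
  convert regular_root (V := V) (fun _ m => ∃ c ∈ m, a ∈ c) using 1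
  ext G
  simp only [Set.mem_ofPred_eq, LTree.mem_label, Multiset.mem_map, Finset.mem_val,
    RTree.mem_children, exists_exists_and_eq_and]
  exact ⟨fun h => ⟨_, h, rfl⟩, by rintro ⟨v, hv, rfl⟩; exact hv⟩

theorem regular_label [Finite V] (a : V) (X : Set V) :
    Regular {G : LTree V | G.label (G.pos a) = X} := by
  convert regular_local (V := V) (fun l _ => a ∈ l → l = X) using 1
  ext G
  simp only [Set.mem_ofPred_eq, LTree.mem_label]
  exact ⟨by rintro h u _ rfl; exact h, fun h => h _ (G.pos_mem a) rfl⟩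

/-! ### Closure under placing and forgetting variables -/

namespace LTree

/-- Rename the variables along `f`. -/
def comap (f : W → V) (G : LTree V) : LTree W where
  toRTree := G.toRTree
  pos := G.pos ∘ f
  pos_mem w := G.pos_mem (f w)

/-- Place one more variable on the node `x`. -/
def extend (G : LTree V) (x : ℕ) (hx : x ∈ G.loc) : LTree (Option V) where
  toRTree := G.toRTree
  pos v := v.elim x G.pos
  pos_mem v := by cases v; exacts [hx, G.pos_mem _]

end LTree

theorem Regular.comap {L : Set (LTree W)} (h : Regular L) (f : W → V) :
    Regular {G : LTree V | G.comap f ∈ L} := by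
  obtain ⟨n, δ, acc, h⟩ := h
  refine ⟨n, fun m l s => δ m (f ⁻¹' l) s, acc, fun G => ?_⟩
  exact h (G.comap f)

/-- Existential quantification over the position of a variable. The automaton guesses the node that
carries the variable; the second component of its state says whether this node is in the
subtree, which makes sure that there is exactly one. -/
theorem Regular.image_comap_some {L : Set (LTree (Option V))} (h : Regular L) :
    Regular (LTree.comap some '' L) := by
  classical
  obtain ⟨n, δ, acc, h⟩ := h
  refine .of_finite (S := Fin n × Prop) (fun m l s => ∃ c : Prop,
    δ (m.map Prod.fst) {v | v.elim c (· ∈ l)} s.1 ∧ (s.2 ↔ c ∨ ∃ x ∈ m, x.2) ∧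
    (c → ∀ x ∈ m, ¬ x.2) ∧ (m.filter (fun x => x.2)).card ≤ 1) {s | s.1 ∈ acc ∧ s.2} fun G => ?_
  constructor
  · rintro ⟨B, hB, rfl⟩
    obtain ⟨ρ, hρ, ha⟩ := (h B).1 hB
    refine ⟨fun u => (ρ u, B.Reach (B.pos none) u), fun u hu => ⟨B.pos none = u, ?_, ?_, ?_, ?_⟩,
      ha, B.reach_dirty (B.pos_mem _)⟩
    · convert hρ u hu using 1
      · simp [Multiset.map_map]; rfl
      · ext v
        cases v <;> simp [LTree.mem_label, LTree.comap]
    · change B.Reach _ u ↔ _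
      rw [B.reach_iff]
      simp [LTree.comap]
    · rintro rfl x hx
      obtain ⟨v, hv, rfl⟩ := Multiset.mem_map.1 hx
      intro h'
      exact B.acyclic _ (Relation.TransGen.tail' h' (B.mem_children.1 hv))
    · rw [Multiset.filter_map, Multiset.card_map]
      change ((B.children u).filter (fun v => B.Reach (B.pos none) v)).card ≤ 1
      refine Finset.card_le_one.2 fun v hv w hw => ?_
      simp only [Finset.mem_filter, RTree.mem_children] at hv hw
      exact B.eq_of_reach_of_next hv.1 hw.1 hv.2 hw.2
  · rintro ⟨ρ, hρ, ha, hb⟩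
    choose! c hc using hρ
    have ex : ∀ u, u ∈ G.loc → (ρ u).2 → ∃ x, G.Reach x u ∧ c x := by
      refine G.induction_down fun u ih hu h => ?_
      rcases (hc u hu).2.1.1 h with h | ⟨x, hx, h⟩
      · exact ⟨u, .refl, h⟩
      · obtain ⟨v, hv, rfl⟩ := Multiset.mem_map.1 hx
        have hv := G.mem_children.1 hv
        obtain ⟨x, hx, h⟩ := ih v hv (G.mem_loc_of_next hv) h
        exact ⟨x, hx.tail hv, h⟩
    have up : ∀ x u, x ∈ G.loc → c x → G.Reach x u → (ρ u).2 := by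
      intro x u hx hcx h
      induction h with
      | refl => exact (hc x hx).2.1.2 (.inl hcx)
      | tail hab h ih =>
        refine (hc _ (G.next_mem _ _ h)).2.1.2 (.inr ⟨_, Multiset.mem_map_of_mem _ ?_, ih⟩)
        exact G.mem_children.2 h
    have un : ∀ u, u ∈ G.loc → ∀ x y, G.Reach x u → G.Reach y u → c x → c y → x = y := by
      refine G.induction_down fun u ih hu x y hx hy hcx hcy => ?_
      have hx' := G.reach_mem_left hu hx
      have hy' := G.reach_mem_left hu hy
      have aux : ∀ x, x ∈ G.loc → c x → c u → G.Reach x u → x = u := by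
        intro x hx hcx hcu h
        rcases Relation.ReflTransGen.cases_tail h with h | ⟨v, hv, h⟩
        · exact h.symm
        · exact ((hc u hu).2.2.1 hcu _ (Multiset.mem_map_of_mem _ (G.mem_children.2 h))
            (up x v hx hcx hv)).elim
      rcases Relation.ReflTransGen.cases_tail hx with hxu | ⟨v, hv, hvu⟩
      · subst hxu
        exact (aux y hy' hcy hcx hy).symm
      rcases Relation.ReflTransGen.cases_tail hy with hyu | ⟨w, hw, hwu⟩
      · subst hyu
        exact aux x hx' hcx hcy hx
      obtain rfl : v = w := by
        have h1 := (hc u hu).2.2.2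
        rw [Multiset.filter_map, Multiset.card_map] at h1
        change ((G.children u).filter (fun v => (ρ v).2)).card ≤ 1 at h1
        refine Finset.card_le_one.1 h1 v ?_ w ?_
        · exact Finset.mem_filter.2 ⟨G.mem_children.2 hvu, up x v hx' hcx hv⟩
        · exact Finset.mem_filter.2 ⟨G.mem_children.2 hwu, up y w hy' hcy hw⟩
      exact ih v hvu (G.mem_loc_of_next hvu) x y hv hw hcx hcy
    obtain ⟨x, hx, hcx⟩ := ex dirty G.dirty_mem hb
    have hxl := G.reach_mem_left G.dirty_mem hx
    refine ⟨G.extend x hxl, (h _).2 ⟨fun u => (ρ u).1, fun u hu => ?_, ha⟩, rfl⟩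
    convert (hc u hu).1 using 1
    · simp [Multiset.map_map]; rfl
    · ext v
      cases v with
      | some v => rfl
      | none =>
        change x = u ↔ c u
        constructor
        · rintro rfl
          exact hcx
        · exact fun h => un dirty G.dirty_mem x u hx (G.reach_dirty hu) hcx h

end

/-! ### Closure under structural changes of the tree -/

theorem acyclic_of_height {next : ℕ → Option ℕ} (h : ℕ → ℕ)
    (hh : ∀ u v, next u = some v → h v < h u) (u : ℕ) :
    ¬ Relation.TransGen (fun a b => next a = some b) u u := by
  have key : ∀ a b, Relation.TransGen (fun a b => next a = some b) a b → h b < h a := by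
    intro a b hab
    induction hab with
    | single h => exact hh _ _ h
    | tail _ h ih => exact (hh _ _ h).trans ih
  exact fun hu => (key u u hu).false

namespace LTree

variable {V S : Type*}

/-- Add the fresh, unlabelled leaf `x` below the node `w`. -/
def addLeaf (G : LTree V) (x w : ℕ) (hx : x ∉ G.loc) (hw : w ∈ G.loc) : LTree V where
  loc := insert x G.loc
  next := Function.update G.next x (some w)
  dirty_mem := Finset.mem_insert_of_mem G.dirty_mem
  next_dirty := by
    rw [Function.update_of_ne, G.next_dirty]
    rintro rfl
    exact hx G.dirty_mem
  next_outside u hu := by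
    simp only [Finset.mem_insert, not_or] at hu
    rw [Function.update_of_ne hu.1, G.next_outside u hu.2]
  next_mem u v h := by
    by_cases hu : u = x
    · subst hu
      simp only [Function.update_self, Option.some.injEq] at h
      exact Finset.mem_insert_of_mem (h ▸ hw)
    · rw [Function.update_of_ne hu] at h
      exact Finset.mem_insert_of_mem (G.next_mem _ _ h)
  next_defined u hu hd := by
    by_cases hux : u = x
    · exact ⟨w, by simp [hux]⟩
    · rw [Function.update_of_ne hux]
      exact G.next_defined u (Finset.mem_of_mem_insert_of_ne hu hux) hd
  acyclic := by
    obtain ⟨h, hh⟩ := G.exists_height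
    refine acyclic_of_height (Function.update h x (h w + 1)) fun u v huv => ?_
    have hv : v ≠ x := by
      rintro rfl
      by_cases hu : u = v
      · subst hu
        simp only [Function.update_self, Option.some.injEq] at huv
        exact hx (huv ▸ hw)
      · rw [Function.update_of_ne hu] at huv
        exact hx (G.next_mem _ _ huv)
    rw [Function.update_of_ne hv]
    by_cases hu : u = x
    · subst hu
      simp only [Function.update_self, Option.some.injEq] at huv ⊢
      exact huv ▸ Nat.lt_succ_self _
    · rw [Function.update_of_ne hu] at huv ⊢
      exact hh _ _ huv
  pos := G.pos
  pos_mem v := Finset.mem_insert_of_mem (G.pos_mem v)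

/-- `G.Sub B`: `G` results from the labelled tree `B` by deleting unlabelled subtrees. -/
def Sub (G B : LTree V) : Prop :=
  G.loc ⊆ B.loc ∧ (∀ u ∈ G.loc, G.next u = B.next u) ∧ G.pos = B.pos

/-- `(s, n)` is garbage if the automaton has a run with root state `s` on an unlabelled tree with
`n` nodes. -/
inductive Garbage (δ : Multiset S → Set V → S → Prop) : S × ℕ → Prop
  | mk (E : Multiset (S × ℕ)) (s : S) (hE : ∀ g ∈ E, Garbage δ g)
      (h : δ (E.map Prod.fst) ∅ s) : Garbage δ (s, (E.map Prod.snd).sum + 1)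

/-- If the transitions at each node `u` may use the states of the garbage trees `e u` in addition to
those of its children, then these trees can be attached, node by node. -/
theorem exists_sub_of_garbage (δ : Multiset S → Set V → S → Prop) (N : ℕ) :
    ∀ (G : LTree V) (ρ : ℕ → S) (e : ℕ → Multiset (S × ℕ)),
      (∀ u ∈ G.loc, ∀ g ∈ e u, Garbage δ g) →
      (∀ u ∈ G.loc, δ ((G.children u).val.map ρ + (e u).map Prod.fst) (G.label u) (ρ u)) →
      ∑ u ∈ G.loc, ((e u).map Prod.snd).sum = N →
      ∃ (B : LTree V) (ρ' : ℕ → S), G.Sub B ∧ B.Run δ ρ' ∧ ρ' dirty = ρ dirty := by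
  classical
  induction N using Nat.strong_induction_on with
  | _ N ih =>
    intro G ρ e he hρ hN
    by_cases h0 : ∀ u ∈ G.loc, e u = 0
    · exact ⟨G, ρ, ⟨subset_rfl, fun _ _ => rfl, rfl⟩,
        fun u hu => by simpa [h0 u hu] using hρ u hu, rfl⟩
    push Not at h0
    obtain ⟨w, hw, hew⟩ := h0
    obtain ⟨g, hg⟩ := Multiset.exists_mem_of_ne_zero hew
    obtain ⟨E, s, hE, hs⟩ := he w hw g hg
    obtain ⟨x, hx⟩ := Infinite.exists_notMem_finset G.loc
    have hxw : w ≠ x := fun h => hx (h ▸ hw)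
    let e' : ℕ → Multiset (S × ℕ) := Function.update
      (Function.update e w ((e w).erase (s, (E.map Prod.snd).sum + 1))) x E
    have hex : e' x = E := by simp [e']
    have hew' : e' w = (e w).erase (s, (E.map Prod.snd).sum + 1) := by simp [e', hxw]
    have heu : ∀ u, u ≠ x → u ≠ w → e' u = e u := fun u h h' => by simp [e', h, h']
    have hlt : ∑ u ∈ insert x G.loc, ((e' u).map Prod.snd).sum < N := by
      rw [Finset.sum_insert hx, ← hN, ← Finset.add_sum_erase _ _ hw,
        ← Finset.add_sum_erase (a := w) G.loc (fun u => ((e u).map Prod.snd).sum) hw, hex, hew']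
      have h1 : ∑ u ∈ G.loc.erase w, ((e' u).map Prod.snd).sum =
          ∑ u ∈ G.loc.erase w, ((e u).map Prod.snd).sum := by
        refine Finset.sum_congr rfl fun u hu => ?_
        rw [heu u (fun h => hx (h ▸ Finset.mem_of_mem_erase hu)) (Finset.ne_of_mem_erase hu)]
      have h2 : ((e w).map Prod.snd).sum = (E.map Prod.snd).sum + 1 +
          (((e w).erase (s, (E.map Prod.snd).sum + 1)).map Prod.snd).sum := by
        conv_lhs => rw [← Multiset.cons_erase hg, Multiset.map_cons, Multiset.sum_cons]
      rw [h1, h2]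
      omega
    have hnx : ∀ u, G.next u ≠ some x := fun u h => hx (G.next_mem _ _ h)
    have hmem : ∀ u v, v ∈ G.children u → v ≠ x := by
      rintro u v hv rfl
      exact hx (G.mem_loc_of_next (G.mem_children.1 hv))
    have hmap : ∀ u, (G.children u).val.map (Function.update ρ x s) =
        (G.children u).val.map ρ := fun u =>
      Multiset.map_congr rfl fun v hv => Function.update_of_ne (hmem u v hv) _ _
    have he₁ : ∀ u ∈ (G.addLeaf x w hx hw).loc, ∀ g ∈ e' u, Garbage δ g := by
      intro u hu g hgu
      rcases Finset.mem_insert.1 hu with rfl | hu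
      · exact hE g (hex ▸ hgu)
      · by_cases huw : u = w
        · subst huw
          exact he u hw g (Multiset.mem_of_mem_erase (hew' ▸ hgu))
        · exact he u hu g (heu u (fun h => hx (h ▸ hu)) huw ▸ hgu)
    have hρ₁ : ∀ u ∈ (G.addLeaf x w hx hw).loc,
        δ (((G.addLeaf x w hx hw).children u).val.map (Function.update ρ x s) +
          (e' u).map Prod.fst) ((G.addLeaf x w hx hw).label u) (Function.update ρ x s u) := by
      intro u hu
      have hch : ∀ u v, v ∈ (G.addLeaf x w hx hw).children u ↔
          (v = x ∧ u = w) ∨ v ∈ G.children u := by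
        intro u v
        rw [RTree.mem_children, RTree.mem_children]
        change Function.update G.next x (some w) v = some u ↔ _
        by_cases hv : v = x
        · subst hv
          simp [G.next_outside v hx, eq_comm]
        · simp [hv]
      rcases Finset.mem_insert.1 hu with rfl | hu
      · have h1 : (G.addLeaf u w hx hw).children u = ∅ := by
          refine Finset.eq_empty_of_forall_notMem fun v hv => ?_
          rcases (hch u v).1 hv with ⟨_, h⟩ | h
          · exact hxw h.symm
          · exact hnx v (G.mem_children.1 h)
        have h2 : (G.addLeaf u w hx hw).label u = ∅ :=
          Set.eq_empty_of_forall_notMem fun v hv => hx (hv ▸ G.pos_mem v)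
        rw [h1, h2, hex, Function.update_self]
        simpa using hs
      · have hux : u ≠ x := fun h => hx (h ▸ hu)
        rw [Function.update_of_ne hux]
        by_cases huw : u = w
        · subst huw
          have h1 : (G.addLeaf x u hx hw).children u = insert x (G.children u) := by
            ext v; simp [hch]
          rw [h1, Finset.insert_val_of_notMem (fun h => hmem u x h rfl), Multiset.map_cons, hew',
            hmap, Function.update_self]
          have h2 := hρ u hw
          rw [← Multiset.cons_erase hg, Multiset.map_cons, Multiset.add_cons] at h2
          rw [Multiset.cons_add]
          exact h2
        · have h1 : (G.addLeaf x w hx hw).children u = G.children u := by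
            ext v; simp [hch, huw]
          rw [h1, heu u hux huw, hmap]
          exact hρ u hu
    obtain ⟨B, ρ', hB, hρ', hd⟩ := ih _ hlt (G.addLeaf x w hx hw) (Function.update ρ x s) e'
      he₁ hρ₁ rfl
    refine ⟨B, ρ', ⟨?_, ?_, hB.2.2⟩, hρ', ?_⟩
    · exact (Finset.subset_insert _ _).trans hB.1
    · intro u hu
      rw [← hB.2.1 u (Finset.mem_insert_of_mem hu)]
      refine (Function.update_of_ne ?_ _ _).symm
      rintro rfl
      exact hx hu
    · rw [hd, Function.update_of_ne]
      rintro rfl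
      exact hx G.dirty_mem

end LTree

section

variable {V : Type*}

open LTree

/-- Deletion of unlabelled subtrees. The automaton guesses the states of the deleted subtrees among
the states that are reachable on unlabelled trees. -/
theorem Regular.prune {L : Set (LTree V)} (h : Regular L) :
    Regular {G : LTree V | ∃ B ∈ L, G.Sub B} := by
  classical
  obtain ⟨n, δ, acc, h⟩ := h
  refine ⟨n, fun m l s => ∃ E : Multiset (Fin n × ℕ), (∀ g ∈ E, Garbage δ g) ∧
    δ (m + E.map Prod.fst) l s, acc, fun G => ⟨?_, ?_⟩⟩
  · rintro ⟨B, hB, hsub, hnext, hpos⟩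
    obtain ⟨ρ, hρ, ha⟩ := (h B).1 hB
    have up : ∀ u v, B.next v = some u → v ∈ G.loc → u ∈ G.loc := fun u v huv hv =>
      G.next_mem v u ((hnext v hv).trans huv)
    have key : ∀ u, u ∈ B.loc → u ∉ G.loc → ∃ k, Garbage δ (ρ u, k) := by
      refine B.induction_down fun u ih hu hu' => ?_
      have h1 : ∀ v, ∃ k, v ∈ B.children u → Garbage δ (ρ v, k) := by
        intro v
        by_cases hv : v ∈ B.children u
        · have hv' := B.mem_children.1 hv
          obtain ⟨k, hk⟩ := ih v hv' (B.mem_loc_of_next hv') fun hvG => hu' (up u v hv' hvG)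
          exact ⟨k, fun _ => hk⟩
        · exact ⟨0, fun h => (hv h).elim⟩
      choose k hk using h1
      refine ⟨_, Garbage.mk ((B.children u).val.map fun v => (ρ v, k v)) (ρ u) ?_ ?_⟩
      · intro g hg
        obtain ⟨v, hv, rfl⟩ := Multiset.mem_map.1 hg
        exact hk v hv
      · have h2 : B.label u = ∅ := Set.eq_empty_of_forall_notMem fun v hv =>
          hu' (hv ▸ (congrFun hpos v) ▸ G.pos_mem v)
        have h3 := hρ u hu
        rw [h2] at h3
        simpa [Multiset.map_map, Function.comp_def] using h3
    choose! k hk using key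
    refine ⟨ρ, fun u hu => ?_, ha⟩
    refine ⟨((B.children u).val.filter (· ∉ G.loc)).map fun v => (ρ v, k v), ?_, ?_⟩
    · intro g hg
      obtain ⟨v, hv, rfl⟩ := Multiset.mem_map.1 hg
      obtain ⟨hv, hv'⟩ := Multiset.mem_filter.1 hv
      exact hk v (B.mem_loc_of_next (B.mem_children.1 hv)) hv'
    · convert hρ u (hsub hu) using 1
      · have h1 : (G.children u).val = (B.children u).val.filter (· ∈ G.loc) := by
          rw [← Finset.filter_val]
          congr 1
          ext v
          rw [Finset.mem_filter, RTree.mem_children, RTree.mem_children]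
          constructor
          · intro hv
            have := G.mem_loc_of_next hv
            exact ⟨(hnext v this).symm.trans hv, this⟩
          · rintro ⟨hv, hvG⟩
            exact (hnext v hvG).trans hv
        rw [h1, Multiset.map_map]
        change _ + Multiset.map ρ _ = _
        rw [← Multiset.map_add, Multiset.filter_add_not]
      · ext v
        rw [mem_label, mem_label, hpos]
  · rintro ⟨ρ, hρ, ha⟩
    choose! e he hδ using hρ
    obtain ⟨B, ρ', hB, hρ', hd⟩ := exists_sub_of_garbage δ _ G ρ e he hδ rfl
    exact ⟨B, (h B).2 ⟨ρ', hρ', hd ▸ ha⟩, hB⟩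

end

section

variable {V : Type*}

namespace LTree

/-- `G.IsRemoval G₀`: the position of the variable `none` in `G` is a leaf which carries no other
variable, and its removal leaves `G₀`. -/
def IsRemoval (G : LTree (Option V)) (G₀ : LTree V) : Prop :=
  G.pos none ∉ G₀.loc ∧ G.loc = insert (G.pos none) G₀.loc ∧
    (∀ u ∈ G₀.loc, G.next u = G₀.next u) ∧ ∀ v, G.pos (some v) = G₀.pos v

/-- Remove the leaf that carries the variable `none`. -/
def remove (G : LTree (Option V)) (hd : G.pos none ≠ dirty)
    (hleaf : ∀ v, G.next v ≠ some (G.pos none)) (hpos : ∀ v, G.pos (some v) ≠ G.pos none) :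
    LTree V where
  loc := G.loc.erase (G.pos none)
  next := Function.update G.next (G.pos none) none
  dirty_mem := Finset.mem_erase.2 ⟨hd.symm, G.dirty_mem⟩
  next_dirty := by rw [Function.update_of_ne hd.symm, G.next_dirty]
  next_outside u hu := by
    by_cases h : u = G.pos none
    · rw [h, Function.update_self]
    · rw [Function.update_of_ne h]
      exact G.next_outside u fun hu' => hu (Finset.mem_erase.2 ⟨h, hu'⟩)
  next_mem u v h := by
    by_cases hu : u = G.pos none
    · simp [hu] at h
    · rw [Function.update_of_ne hu] at h
      refine Finset.mem_erase.2 ⟨?_, G.next_mem _ _ h⟩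
      rintro rfl
      exact hleaf u h
  next_defined u hu hd := by
    rw [Function.update_of_ne (Finset.ne_of_mem_erase hu)]
    exact G.next_defined u (Finset.mem_of_mem_erase hu) hd
  acyclic u hu := by
    refine G.acyclic u (Relation.TransGen.mono (fun a b h => ?_) u u hu)
    by_cases ha : a = G.pos none
    · simp [ha] at h
    · rwa [Function.update_of_ne ha] at h
  pos v := G.pos (some v)
  pos_mem v := Finset.mem_erase.2 ⟨hpos v, G.pos_mem _⟩

theorem isRemoval_remove (G : LTree (Option V)) (hd : G.pos none ≠ dirty)
    (hleaf : ∀ v, G.next v ≠ some (G.pos none)) (hpos : ∀ v, G.pos (some v) ≠ G.pos none) :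
    G.IsRemoval (G.remove hd hleaf hpos) :=
  ⟨Finset.notMem_erase _ _, (Finset.insert_erase (G.pos_mem none)).symm,
    fun _ hu => (Function.update_of_ne (Finset.ne_of_mem_erase hu) _ _).symm, fun _ => rfl⟩

theorem IsRemoval.next_ne {G : LTree (Option V)} {G₀ : LTree V} (h : G.IsRemoval G₀) {v : ℕ}
    (hv : G.next v = some (G.pos none)) : False := by
  have hvl := G.mem_loc_of_next hv
  rw [h.2.1] at hvl
  rcases Finset.mem_insert.1 hvl with rfl | hvl
  · exact G.acyclic _ (.single hv)
  · exact h.1 (G₀.next_mem _ _ ((h.2.2.1 v hvl).symm.trans hv))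

theorem IsRemoval.children_val {G : LTree (Option V)} {G₀ : LTree V}
    (h : G.IsRemoval G₀) (u : ℕ) :
    (G₀.children u).val = (G.children u).val.filter (· ≠ G.pos none) := by
  rw [← Finset.filter_val]
  congr 1
  ext v
  rw [Finset.mem_filter, RTree.mem_children, RTree.mem_children]
  constructor
  · intro hv
    have hvl := G₀.mem_loc_of_next hv
    exact ⟨(h.2.2.1 v hvl).trans hv, fun he => h.1 (he ▸ hvl)⟩
  · rintro ⟨hv, hne⟩
    have hvl := G.mem_loc_of_next hv
    rw [h.2.1] at hvl
    exact (h.2.2.1 v ((Finset.mem_insert.1 hvl).resolve_left hne)).symm.trans hv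

/-- `G.IsReattach a b G₀`: redirecting the parent edge of the node of `a` to the node of `b` turns
`G` into `G₀`. -/
def IsReattach (G : LTree V) (a b : V) (G₀ : LTree V) : Prop :=
  G₀.loc = G.loc ∧ G₀.next = Function.update G.next (G.pos a) (some (G.pos b)) ∧ G₀.pos = G.pos

/-- Redirect the parent edge of the node of `a` to the node of `b`. -/
def reattach (G : LTree V) (a b : V) (h : ¬ G.Reach (G.pos b) (G.pos a)) : LTree V where
  loc := G.loc
  next := Function.update G.next (G.pos a) (some (G.pos b))
  dirty_mem := G.dirty_mem
  next_dirty := by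
    rw [Function.update_of_ne, G.next_dirty]
    intro hd
    exact h (hd ▸ G.reach_dirty (G.pos_mem b))
  next_outside u hu := by
    rw [Function.update_of_ne, G.next_outside u hu]
    rintro rfl
    exact hu (G.pos_mem a)
  next_mem u v huv := by
    by_cases hu : u = G.pos a
    · subst hu
      simp only [Function.update_self, Option.some.injEq] at huv
      exact huv ▸ G.pos_mem b
    · rw [Function.update_of_ne hu] at huv
      exact G.next_mem _ _ huv
  next_defined u hu hd := by
    by_cases hua : u = G.pos a
    · exact ⟨G.pos b, by simp [hua]⟩
    · rw [Function.update_of_ne hua]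
      exact G.next_defined u hu hd
  acyclic := by
    classical
    obtain ⟨f, hf⟩ := G.exists_height
    -- The moved subtree is lifted above the node of `b`.
    refine acyclic_of_height
      (fun y => if G.Reach y (G.pos a) then f y + f (G.pos b) + 1 else f y) fun u v huv => ?_
    by_cases hu : u = G.pos a
    · subst hu
      simp only [Function.update_self, Option.some.injEq] at huv
      subst huv
      have : G.Reach (G.pos a) (G.pos a) := .refl
      simp only [h, this, if_true, if_false]
      omega
    · rw [Function.update_of_ne hu] at huv
      have h1 := hf _ _ huv
      by_cases hv : G.Reach v (G.pos a)
      · have h2 : G.Reach u (G.pos a) := .head huv hv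
        simp only [hv, h2, if_true]
        omega
      · simp only [hv, if_false]
        split <;> omega
  pos := G.pos
  pos_mem := G.pos_mem

theorem IsReattach.not_reach {G G₀ : LTree V} {a b : V} (h : G.IsReattach a b G₀) :
    ¬ G.Reach (G.pos b) (G.pos a) := by
  intro hr
  have key : ∀ y, G.Reach y (G.pos a) → G₀.Reach y (G.pos a) := by
    intro y hy
    induction hy using Relation.ReflTransGen.head_induction_on with
    | refl => exact .refl
    | @head y z hyz _ ih =>
      by_cases hya : y = G.pos a
      · exact hya ▸ .refl
      · refine .head ?_ ih
        rw [h.2.1, Function.update_of_ne hya]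
        exact hyz
  refine G₀.acyclic (G.pos a) (Relation.TransGen.head' ?_ (key _ hr))
  rw [h.2.1, Function.update_self]

theorem IsReattach.children_map {α : Type*} {G G₀ : LTree V} {a b : V}
    (h : G.IsReattach a b G₀) (u : ℕ) (ρ : ℕ → α) :
    (G₀.children u).val.map ρ =
      ((G.children u).val.filter (· ≠ G.pos a)).map ρ +
        if G.pos b = u then {ρ (G.pos a)} else 0 := by
  have hch : ∀ v, v ∈ G₀.children u ↔
      (v ∈ (G.children u).filter (· ≠ G.pos a)) ∨ (v = G.pos a ∧ G.pos b = u) := by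
    intro v
    rw [RTree.mem_children, Finset.mem_filter, RTree.mem_children, h.2.1]
    by_cases hv : v = G.pos a
    · subst hv
      simp
    · simp [hv]
  have hn : G.pos a ∉ (G.children u).filter (· ≠ G.pos a) := by simp
  by_cases hb : G.pos b = u
  · have : G₀.children u = insert (G.pos a) ((G.children u).filter (· ≠ G.pos a)) := by
      ext v
      rw [hch, Finset.mem_insert, or_comm]
      simp [hb]
    rw [this, Finset.insert_val_of_notMem hn, if_pos hb, Multiset.map_cons, Finset.filter_val,
      add_comm, Multiset.singleton_add]
  · have : G₀.children u = (G.children u).filter (· ≠ G.pos a) := by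
      ext v
      rw [hch]
      simp [hb]
    rw [this, if_neg hb, Finset.filter_val, add_zero]

end LTree

open LTree

theorem filterMap_eq_map_filter {α : Type*} (M : Multiset ℕ) (x : ℕ) (ρ : ℕ → Option α)
    (g : ℕ → α) (h : ∀ v ∈ M, v = x → ρ v = none) (h' : ∀ v ∈ M, v ≠ x → ρ v = some (g v)) :
    M.filterMap ρ = (M.filter (· ≠ x)).map g := by
  induction M using Multiset.induction_on with
  | empty => simp
  | cons v M ih =>
    have ih := ih (fun w hw => h w (Multiset.mem_cons_of_mem hw))
      (fun w hw => h' w (Multiset.mem_cons_of_mem hw))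
    by_cases hv : v = x
    · rw [Multiset.filter_cons_of_neg _ (by simpa using hv), ← ih,
        Multiset.filterMap_cons_none _ _ (h v (Multiset.mem_cons_self v M) hv)]
    · rw [Multiset.filter_cons_of_pos (p := (· ≠ x)) _ hv, Multiset.map_cons, ← ih,
        Multiset.filterMap_cons_some _ _ _ (h' v (Multiset.mem_cons_self v M) hv)]

theorem Regular.remove {L : Set (LTree V)} (h : Regular L) :
    Regular {G : LTree (Option V) | ∃ G₀ ∈ L, G.IsRemoval G₀} := by
  classical
  obtain ⟨n, δ, acc, h⟩ := h
  -- The removed leaf has the state `none`, which its parent ignores.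
  refine .of_finite (S := Option (Fin n)) (fun m l s => match s with
    | none => none ∈ l ∧ m = 0 ∧ ∀ v, some v ∉ l
    | some s => none ∉ l ∧ δ (m.filterMap id) {v | some v ∈ l} s)
    {s | ∃ s' ∈ acc, s = some s'} fun G => ⟨?_, ?_⟩
  · rintro ⟨G₀, hG₀, hr⟩
    obtain ⟨ρ, hρ, ha⟩ := (h G₀).1 hG₀
    have hne : ∀ u ∈ G₀.loc, u ≠ G.pos none := fun u hu he => hr.1 (he ▸ hu)
    refine ⟨fun u => if u = G.pos none then none else some (ρ u), fun u hu => ?_,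
      ρ dirty, ha, if_neg (hne _ G₀.dirty_mem)⟩
    dsimp only
    rw [hr.2.1] at hu
    by_cases hx : u = G.pos none
    · rw [if_pos hx]
      subst hx
      refine ⟨rfl, ?_, fun v hv => ?_⟩
      · rw [Multiset.map_eq_zero, Finset.val_eq_zero]
        exact Finset.eq_empty_of_forall_notMem fun v hv => hr.next_ne (G.mem_children.1 hv)
      · exact hr.1 (hv ▸ hr.2.2.2 v ▸ G₀.pos_mem v)
    · rw [if_neg hx]
      have hu := (Finset.mem_insert.1 hu).resolve_left hx
      refine ⟨fun h => hx h.symm, ?_⟩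
      convert hρ u hu using 1
      · rw [hr.children_val u, Multiset.filterMap_map]
        refine filterMap_eq_map_filter _ _ _ _ (fun v _ hv => ?_) (fun v _ hv => ?_)
        · simp [hv]
        · simp [hv]
      · ext v
        rw [mem_label, ← hr.2.2.2]
        rfl
  · rintro ⟨ρ, hρ, s₀, ha, hd⟩
    have hnone : ∀ u ∈ G.loc, (ρ u = none ↔ u = G.pos none) := by
      intro u hu
      have := hρ u hu
      cases hs : ρ u with
      | none => rw [hs] at this; simpa using this.1.symm
      | some s => rw [hs] at this; simpa using fun h : u = G.pos none => this.1 h.symm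
    have hx := hρ _ (G.pos_mem none)
    rw [(hnone _ (G.pos_mem none)).2 rfl] at hx
    have hxd : G.pos none ≠ dirty := by
      intro he
      have := (hnone _ G.dirty_mem).2 he.symm
      rw [hd] at this
      cases this
    have hleaf : ∀ v, G.next v ≠ some (G.pos none) := by
      intro v hv
      have := hx.2.1
      rw [Multiset.map_eq_zero, Finset.val_eq_zero] at this
      exact Finset.notMem_empty v (this ▸ G.mem_children.2 hv)
    have hr := G.isRemoval_remove hxd hleaf hx.2.2
    refine ⟨_, (h _).2 ⟨fun u => (ρ u).getD s₀, fun u hu => ?_, ?_⟩, hr⟩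
    · have hu' : u ∈ G.loc := hr.2.1 ▸ Finset.mem_insert_of_mem hu
      have hux : u ≠ G.pos none := fun he => hr.1 (he ▸ hu)
      have h1 := hρ u hu'
      obtain ⟨s, hs⟩ := Option.ne_none_iff_exists'.1 fun he => hux ((hnone u hu').1 he)
      rw [hs] at h1
      dsimp only
      rw [hs, Option.getD_some]
      convert h1.2 using 1
      · rw [hr.children_val u, Multiset.filterMap_map]
        have key : ∀ v ∈ (G.children u).val, (ρ v = none ↔ v = G.pos none) := fun v hv =>
          hnone v (G.mem_loc_of_next (G.mem_children.1 hv))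
        refine (filterMap_eq_map_filter _ _ _ _ (fun v hv hvx => (key v hv).2 hvx)
          (fun v hv hvx => ?_)).symm
        obtain ⟨s, hs⟩ := Option.ne_none_iff_exists'.1 fun he => hvx ((key v hv).1 he)
        simp [hs]
      · rfl
    · simpa [hd] using ha

/-- Redirecting an edge. The automaton guesses the state of the moved subtree and supplies it to the
transition at the node of `b`. -/
theorem Regular.reattach {L : Set (LTree V)} (h : Regular L) (a b : V) :
    Regular {G : LTree V | ∃ G₀ ∈ L, G.IsReattach a b G₀} := by
  classical
  obtain ⟨n, δ, acc, h⟩ := h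
  -- A state `(s, here, below, r)` of a node consists of its state `s` in the modified tree, whether
  -- `a` is placed on it, whether `b` is placed in its subtree, and the guessed state of `a`.
  refine .of_finite (S := Fin n × Prop × Prop × Fin n) (fun m l s =>
    (s.2.1 ↔ a ∈ l) ∧ (s.2.2.1 ↔ b ∈ l ∨ ∃ x ∈ m, x.2.2.1) ∧ (∀ x ∈ m, x.2.2.2 = s.2.2.2) ∧
    (a ∈ l → s.1 = s.2.2.2) ∧ (a ∈ l → ¬ s.2.2.1) ∧
    δ ((m.filter (fun x => ¬ x.2.1)).map Prod.fst + if b ∈ l then {s.2.2.2} else 0) l s.1)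
    {s | s.1 ∈ acc} fun G => ⟨?_, ?_⟩
  · rintro ⟨G₀, hG₀, hr⟩
    obtain ⟨ρ, hρ, ha⟩ := (h G₀).1 hG₀
    refine ⟨fun u => (ρ u, G.pos a = u, G.Reach (G.pos b) u, ρ (G.pos a)), fun u hu => ?_, ha⟩
    refine ⟨Iff.rfl, ?_, ?_, ?_, ?_, ?_⟩
    · change G.Reach _ u ↔ _
      rw [G.reach_iff]
      simp [mem_label]
    · intro x hx
      obtain ⟨v, _, rfl⟩ := Multiset.mem_map.1 hx
      rfl
    · rintro rfl
      rfl
    · rintro rfl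
      exact hr.not_reach
    · have h1 := hρ u (hr.1 ▸ hu)
      rw [hr.children_map] at h1
      convert h1 using 1
      · congr 1
        · rw [Multiset.filter_map, Multiset.map_map]
          congr 1
          refine Multiset.filter_congr fun v _ => ?_
          simp [eq_comm]
        · simp [mem_label]
      · ext v
        rw [mem_label, mem_label, hr.2.2]
  · rintro ⟨ρ, hρ, ha⟩
    have hb : ∀ u, u ∈ G.loc → ((ρ u).2.2.1 ↔ G.Reach (G.pos b) u) := by
      refine G.induction_down fun u ih hu => ?_
      rw [(hρ u hu).2.1, G.reach_iff]
      refine or_congr Iff.rfl ⟨?_, ?_⟩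
      · rintro ⟨x, hx, hxb⟩
        obtain ⟨v, hv, rfl⟩ := Multiset.mem_map.1 hx
        have hv' := G.mem_children.1 hv
        exact ⟨v, hv, (ih v hv' (G.mem_loc_of_next hv')).1 hxb⟩
      · rintro ⟨v, hv, hvb⟩
        have hv' := G.mem_children.1 hv
        exact ⟨_, Multiset.mem_map_of_mem _ hv, (ih v hv' (G.mem_loc_of_next hv')).2 hvb⟩
    have hconst : ∀ u ∈ G.loc, (ρ u).2.2.2 = (ρ dirty).2.2.2 := fun u hu =>
      G.induction_up (P := fun u => (ρ u).2.2.2 = (ρ dirty).2.2.2) rfl (fun u v hv ih =>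
        ((hρ u (G.next_mem _ _ hv)).2.2.1 _
          (Multiset.mem_map_of_mem _ (G.mem_children.2 hv))).trans ih) hu
    have hreach : ¬ G.Reach (G.pos b) (G.pos a) := fun h' =>
      (hρ _ (G.pos_mem a)).2.2.2.2.1 rfl ((hb _ (G.pos_mem a)).2 h')
    have hr : G.IsReattach a b (G.reattach a b hreach) := ⟨rfl, rfl, rfl⟩
    refine ⟨_, (h _).2 ⟨fun u => (ρ u).1, fun u hu => ?_, ha⟩, hr⟩
    rw [hr.children_map]
    convert (hρ u hu).2.2.2.2.2 using 1
    swap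
    · rfl
    congr 1
    · rw [Multiset.filter_map, Multiset.map_map]
      congr 1
      refine Multiset.filter_congr fun v hv => not_congr ?_
      rw [(hρ v (G.mem_loc_of_next (G.mem_children.1 hv))).1, mem_label,
        eq_comm]
    · have h1 : (ρ (G.pos a)).1 = (ρ u).2.2.2 := by
        rw [(hρ _ (G.pos_mem a)).2.2.2.1 rfl, hconst _ (G.pos_mem a), hconst u hu]
      simp [h1, mem_label]

end

/-! ### Symbolic trees and automata runs -/

section

variable {PV Y F D : Type*} {nil : PV}

/-- The rooted tree of a pointer structure. -/
def Shape.toRTree (σ : Shape PV nil) : RTree where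
  loc := σ.loc
  next := σ.next
  dirty_mem := σ.dirty_mem
  next_dirty := σ.next_dirty
  next_outside := σ.next_outside
  next_mem := σ.next_mem
  next_defined := σ.next_defined
  acyclic := σ.acyclic

/-- The labelled tree of a symbolic tree. -/
def SymTree.toLTree (t : SymTree PV nil Y) : LTree (PV ⊕ Y) where
  toRTree := t.shape.toRTree
  pos := t.pos
  pos_mem
    | .inl p => t.shape.pval_mem p
    | .inr y => t.val_mem y

/-- The labelled trees that come from symbolic trees: no node carries two universal variables, every
leaf carries a pointer variable, and `nil` is placed on a child of the root. In a finite tree, the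
condition on the leaves says that every node is reachable from a pointer variable. -/
def symTrees (nil : PV) : Set (LTree (PV ⊕ Y)) :=
  {G | (∀ u ∈ G.loc, ∀ y y', Sum.inr y ∈ G.label u → Sum.inr y' ∈ G.label u → y = y') ∧
    (∀ u ∈ G.loc, G.children u = ∅ → ∃ p, Sum.inl p ∈ G.label u) ∧
    G.next (G.pos (Sum.inl nil)) = some dirty}

theorem SymTree.toLTree_mem (t : SymTree PV nil Y) : t.toLTree ∈ symTrees nil := by
  refine ⟨fun u _ y y' h h' => t.val_injective (h.trans h'.symm), fun u hu hc => ?_,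
    t.shape.next_nil⟩
  obtain ⟨p, hp⟩ := t.shape.reachable u hu
  rcases Relation.ReflTransGen.cases_tail hp with h | ⟨v, _, h⟩
  · exact ⟨p, h.symm⟩
  · exact (Finset.notMem_empty v (hc ▸ t.toLTree.mem_children.2 h)).elim

theorem exists_symTree {G : LTree (PV ⊕ Y)} (h : G ∈ symTrees nil) :
    ∃ t : SymTree PV nil Y, t.toLTree = G := by
  have hreach : ∀ u, u ∈ G.loc → ∃ p, G.Reach (G.pos (Sum.inl p)) u := by
    refine G.induction_down fun u ih hu => ?_
    rcases (G.children u).eq_empty_or_nonempty with hc | ⟨v, hv⟩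
    · obtain ⟨p, rfl⟩ := h.2.1 u hu hc
      exact ⟨p, .refl⟩
    · have hv := G.mem_children.1 hv
      obtain ⟨p, hp⟩ := ih v hv (G.mem_loc_of_next hv)
      exact ⟨p, hp.tail hv⟩
  refine ⟨⟨⟨G.loc, G.next, fun p => G.pos (Sum.inl p), G.dirty_mem, G.next_dirty, G.next_outside,
    G.next_mem, G.next_defined, G.acyclic, fun p => G.pos_mem _, hreach, h.2.2⟩,
    fun y => G.pos (Sum.inr y), fun y => G.pos_mem _, fun y y' hy =>
      h.1 _ (G.pos_mem _) y y' hy rfl⟩, ?_⟩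
  ext v
  · rfl
  · rfl
  · cases v <;> rfl

theorem SymTree.toLTree_injective {t t' : SymTree PV nil Y} (h : t.toLTree = t'.toLTree) :
    t = t' := by
  obtain ⟨⟨loc, next, pval, _, _, _, _, _, _, _, _, _⟩, val, _, _⟩ := t
  obtain ⟨⟨loc', next', pval', _, _, _, _, _, _, _, _, _⟩, val', _, _⟩ := t'
  have h1 : loc = loc' := congrArg (fun G => G.loc) h
  have h2 : next = next' := congrArg (fun G => G.next) h
  have h3 := congrArg LTree.pos h
  have h4 : pval = pval' := funext fun p => congrFun h3 (Sum.inl p)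
  have h5 : val = val' := funext fun y => congrFun h3 (Sum.inr y)
  subst h1 h2 h4 h5
  rfl

theorem regular_symTrees [Finite PV] [Finite Y] (nil : PV) :
    Regular (symTrees (Y := Y) nil) := by
  have h1 := regular_local (V := PV ⊕ Y) fun l m =>
    (∀ y y', Sum.inr y ∈ l → Sum.inr y' ∈ l → y = y') ∧ (m = 0 → ∃ p, Sum.inl p ∈ l)
  convert h1.inter (regular_next_dirty (Sum.inl nil)) using 1
  ext G
  simp only [symTrees, Multiset.map_eq_zero, Finset.val_eq_zero]
  constructor
  · exact fun h => ⟨fun u hu => ⟨h.1 u hu, h.2.1 u hu⟩, h.2.2⟩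
  · exact fun h => ⟨fun u hu => (h.1 u hu).1, fun u hu => (h.1 u hu).2, h.2⟩

open Classical in
/-- The universal variable in a set of labels, `none` if there is none. -/
noncomputable def univOf (l : Set (PV ⊕ Y)) : Option Y :=
  if h : ∃ y, Sum.inr y ∈ l then some h.choose else none

theorem SymTree.univLabel_eq_some (t : SymTree PV nil Y) {u : ℕ} {y : Y} :
    t.univLabel u = some y ↔ t.val y = u := by
  unfold SymTree.univLabel
  constructor
  · intro h
    split at h
    · rename_i h'
      exact Option.some_injective _ h ▸ h'.choose_spec
    · cases h
  · intro h
    have h' : ∃ y, t.val y = u := ⟨y, h⟩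
    rw [dif_pos h']
    exact congrArg some (t.val_injective (h'.choose_spec.trans h.symm))

theorem SymTree.label_eq (t : SymTree PV nil Y) (u : ℕ) :
    t.toLTree.label u =
      Sum.inl '' t.shape.ptrLabel u ∪ Sum.inr '' {y | t.univLabel u = some y} := by
  ext v
  cases v with
  | inl p => simp [LTree.mem_label, Shape.ptrLabel, SymTree.toLTree, SymTree.pos]
  | inr y =>
    simp [LTree.mem_label, t.univLabel_eq_some, SymTree.toLTree, SymTree.pos]

variable [Fintype PV]

namespace QSDA

/-- The conditions that `QSDA.IsRun` imposes on one node: `m` are the states of its children, `l` is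
its set of labels and `s` its state. -/
def Local (A : QSDA PV Y F) (m : Multiset (Fin A.n)) (l : Set (PV ⊕ Y)) (s : Fin A.n) : Prop :=
  (∃ (i : Fin (Fintype.card PV + 1)) (m' : Sym (Fin A.n) i), (m' : Multiset (Fin A.n)) = m ∧
    A.Δ i m' (Sum.inl ⁻¹' l, univOf l) = some s) ∧
  (m = 0 → ∃ p, Sum.inl p ∈ A.typ s) ∧
  (∀ s' ∈ m, ∀ p, Sum.inl p ∈ l → Sum.inl p ∉ A.typ s') ∧
  (∀ s' ∈ m, ∀ y, univOf l = some y → Sum.inr y ∉ A.typ s') ∧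
  (m ≠ 0 → A.typ s = Sum.inl '' (Sum.inl ⁻¹' l) ∪ Sum.inr '' {y | univOf l = some y} ∪
    ⋃ s' ∈ m, A.typ s')

theorem isRun_iff (A : QSDA PV Y F) (t : SymTree PV nil Y) (ρ : ℕ → Fin A.n) :
    A.IsRun t ρ ↔ t.toLTree.Run A.Local ρ ∧ A.typ (ρ dirty) = Set.univ := by
  have hz : ∀ u, (t.shape.children u).val.map ρ = 0 ↔ t.shape.children u = ∅ := fun u => by
    rw [Multiset.map_eq_zero, Finset.val_eq_zero]
  have hU : ∀ u, (⋃ s' ∈ (t.shape.children u).val.map ρ, A.typ s') =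
      ⋃ v ∈ t.shape.children u, A.typ (ρ v) := fun u => by
    ext x; simp
  constructor
  · rintro ⟨h1, h2, h3, h4, h5, h6⟩
    refine ⟨fun u hu => ⟨h1 u hu, fun h => h2 u hu ((hz u).1 h), ?_, ?_, fun h => ?_⟩, h6⟩
    · intro s' hs'
      obtain ⟨v, hv, rfl⟩ := Multiset.mem_map.1 hs'
      exact h3 u hu v hv
    · intro s' hs'
      obtain ⟨v, hv, rfl⟩ := Multiset.mem_map.1 hs'
      exact h4 u hu v hv
    · exact (h5 u hu fun h' => h ((hz u).2 h')).trans (congrArg _ (hU u).symm)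
  · rintro ⟨h, h6⟩
    refine ⟨fun u hu => (h u hu).1, fun u hu hc => (h u hu).2.1 ((hz u).2 hc),
      fun u hu v hv => (h u hu).2.2.1 _ (Multiset.mem_map_of_mem _ hv),
      fun u hu v hv => (h u hu).2.2.2.1 _ (Multiset.mem_map_of_mem _ hv), fun u hu hc => ?_, h6⟩
    exact ((h u hu).2.2.2.2 fun h' => hc ((hz u).1 h')).trans (congrArg _ (hU u))

/-- The symbolic trees on which the automaton has a run with root state `q`. -/
def runLang (nil : PV) (A : QSDA PV Y F) (q : Fin A.n) : Set (LTree (PV ⊕ Y)) :=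
  {G | ∃ t : SymTree PV nil Y, t.toLTree = G ∧ ∃ ρ, A.IsRun t ρ ∧ ρ dirty = q}

theorem mem_runLang (A : QSDA PV Y F) {q : Fin A.n} {t : SymTree PV nil Y} :
    t.toLTree ∈ A.runLang nil q ↔ ∃ ρ, A.IsRun t ρ ∧ ρ dirty = q := by
  constructor
  · rintro ⟨t', h, hρ⟩
    exact SymTree.toLTree_injective h ▸ hρ
  · exact fun h => ⟨t, rfl, h⟩

theorem regular_runLang [Finite Y] (A : QSDA PV Y F) (q : Fin A.n) :
    Regular (A.runLang nil q) := by
  have h1 : Regular {G : LTree (PV ⊕ Y) | ∃ ρ, G.Run A.Local ρ ∧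
      ρ dirty ∈ {s | A.typ s = Set.univ ∧ s = q}} :=
    .of_finite A.Local _ fun G => Iff.rfl
  convert (regular_symTrees nil).inter h1 using 1
  ext G
  constructor
  · rintro ⟨t, rfl, ρ, hρ, hd⟩
    have := (A.isRun_iff t ρ).1 hρ
    exact ⟨t.toLTree_mem, ρ, this.1, this.2, hd⟩
  · rintro ⟨hG, ρ, hρ, htyp, hd⟩
    obtain ⟨t, rfl⟩ := exists_symTree hG
    exact ⟨t, rfl, ρ, (A.isRun_iff t ρ).2 ⟨hρ, htyp⟩, hd⟩

theorem Local.unique {A : QSDA PV Y F} {m : Multiset (Fin A.n)} {l : Set (PV ⊕ Y)}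
    {s s' : Fin A.n} (h : A.Local m l s) (h' : A.Local m l s') : s = s' := by
  obtain ⟨⟨i, M, hM, hs⟩, -⟩ := h
  obtain ⟨⟨i', M', hM', hs'⟩, -⟩ := h'
  obtain rfl : i = i' := by
    refine Fin.ext ?_
    rw [← M.2, ← M'.2]
    exact congrArg Multiset.card (hM.trans hM'.symm)
  obtain rfl : M = M' := Sym.coe_injective (hM.trans hM'.symm)
  exact Option.some_injective _ (hs.symm.trans hs')

theorem IsRun.unique {A : QSDA PV Y F} {t : SymTree PV nil Y} {ρ ρ' : ℕ → Fin A.n}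
    (h : A.IsRun t ρ) (h' : A.IsRun t ρ') : ρ dirty = ρ' dirty := by
  rw [isRun_iff] at h h'
  exact h.1.unique (fun _ _ _ _ => Local.unique) h'.1 t.toLTree.dirty_mem

end QSDA

theorem SymTree.card_children_le (t : SymTree PV nil Y) (u : ℕ) :
    (t.toLTree.children u).card ≤ Fintype.card PV := by
  classical
  have : ∀ v : ℕ, ∃ p, v ∈ t.toLTree.children u → t.toLTree.Reach (t.shape.pval p) v := by
    intro v
    by_cases hv : v ∈ t.toLTree.children u
    · obtain ⟨p, hp⟩ := t.shape.reachable v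
        (t.toLTree.mem_loc_of_next (t.toLTree.mem_children.1 hv))
      exact ⟨p, fun _ => hp⟩
    · exact ⟨nil, fun h => (hv h).elim⟩
  choose p hp using this
  refine Finset.card_le_card_of_injOn p (fun _ _ => Finset.mem_univ _) ?_
  intro v hv w hw hvw
  exact t.toLTree.eq_of_reach_of_next (t.toLTree.mem_children.1 hv) (t.toLTree.mem_children.1 hw)
    (hp v hv) (hvw ▸ hp w hw)

end

/-! ### Construction of quantified skinny-tree automata -/

section

variable {PV Y F : Type*} [Fintype PV]

open Classical in
/-- The transition function of `simulation`. Besides the state of the deterministic tree automaton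
`step`, a state contains the set of variables placed in the subtree and whether `nil` is placed on
the node itself. A node with a child that carries `nil` is the root, and its transition is undefined
when `R` relates its state to no formula. -/
noncomputable def simulationStep {S : Type*} (nil : PV) (step : Multiset S → Set (PV ⊕ Y) → S)
    (R : S → F → Prop) (M : Multiset (S × Set (PV ⊕ Y) × Prop)) (l : Set (PV ⊕ Y)) :
    Option (S × Set (PV ⊕ Y) × Prop) :=
  if (∃ c ∈ M, c.2.2) ∧ ¬ ∃ φ, R (step (M.map Prod.fst) l) φ then none
  else some (step (M.map Prod.fst) l, l ∪ ⋃ c ∈ M, c.2.1, Sum.inl nil ∈ l)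

open Classical in
/-- The quantified automaton that simulates the deterministic tree automaton `step` and has the
formula that `R` relates to the root state as output. -/
noncomputable def simulation {S : Type*} (nil : PV) (step : Multiset S → Set (PV ⊕ Y) → S)
    (R : S → F → Prop) (φ₀ : F) {n : ℕ} (e : S × Set (PV ⊕ Y) × Prop ≃ Fin n) : QSDA PV Y F where
  n := n
  Δ _ m x := (simulationStep nil step R ((m : Multiset (Fin n)).map e.symm)
    (Sum.inl '' x.1 ∪ Sum.inr '' {y | x.2 = some y})).map e
  typ s := (e.symm s).2.1
  f s := if h : ∃ φ, R (e.symm s).1 φ then h.choose else φ₀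

theorem mem_formulaLang_simulation {S : Type*} (nil : PV)
    (step : Multiset S → Set (PV ⊕ Y) → S) (R : S → F → Prop)
    (hR : ∀ s φ φ', R s φ → R s φ' → φ = φ') (φ₀ : F) {n : ℕ}
    (e : S × Set (PV ⊕ Y) × Prop ≃ Fin n) (t : SymTree PV nil Y) (φ : F) (ρ : ℕ → S)
    (hρ : ∀ u ∈ t.toLTree.loc,
      ρ u = step ((t.toLTree.children u).val.map ρ) (t.toLTree.label u)) :
    (t, φ) ∈ (simulation nil step R φ₀ e).formulaLang nil ↔ R (ρ dirty) φ := by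
  classical
  have hnil : t.shape.pval nil ∈ t.shape.children dirty :=
    t.toLTree.mem_children.2 t.shape.next_nil
  have hf : ∀ s φ, R (e.symm s).1 φ → (simulation nil step R φ₀ e).f s = φ := by
    intro s φ h
    have h' : ∃ φ, R (e.symm s).1 φ := ⟨φ, h⟩
    exact (dif_pos h').trans (hR _ _ _ h'.choose_spec h)
  constructor
  · rintro ⟨(τ : ℕ → Fin n), hτ, hd⟩
    have key : ∀ u ∈ t.toLTree.loc,
        ¬ ((∃ c ∈ (t.toLTree.children u).val.map (fun v => e.symm (τ v)), c.2.2) ∧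
          ¬ ∃ φ, R (e.symm (τ u)).1 φ) ∧
        (e.symm (τ u)).1 = step ((t.toLTree.children u).val.map fun v => (e.symm (τ v)).1)
          (t.toLTree.label u) ∧ ((e.symm (τ u)).2.2 = (Sum.inl nil ∈ t.toLTree.label u)) := by
      intro u hu
      obtain ⟨i, (m : Sym (Fin n) i), hm, h⟩ := hτ.trans u hu
      have hm' : Multiset.map e.symm (m : Multiset (Fin n)) =
          (t.toLTree.children u).val.map (fun v => e.symm (τ v)) :=
        (congrArg (Multiset.map e.symm) hm).trans (Multiset.map_map _ _ _)
      replace h : (simulationStep nil step R (Multiset.map e.symm (m : Multiset (Fin n)))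
        (Sum.inl '' t.shape.ptrLabel u ∪ Sum.inr '' {y | t.univLabel u = some y})).map e =
          some (τ u) := h
      rw [hm', ← t.label_eq, simulationStep, Multiset.map_map] at h
      split at h
      · cases h
      · rename_i hn
        rw [Option.map_some, Option.some.injEq] at h
        rw [← h, Equiv.symm_apply_apply]
        exact ⟨hn, rfl, rfl⟩
    have hrun : ρ dirty = (e.symm (τ dirty)).1 :=
      LTree.Run.unique (δ := fun m l s => s = step m l) (G := t.toLTree) hρ
        (fun _ _ _ _ h h' => h.trans h'.symm) (fun u hu => (key u hu).2.1) t.toLTree.dirty_mem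
    have h1 := (key dirty t.toLTree.dirty_mem).1
    rw [not_and_not_right] at h1
    obtain ⟨φ', hφ'⟩ := h1 ⟨_, Multiset.mem_map_of_mem _ hnil, by
      rw [(key _ (t.shape.pval_mem nil)).2.2]; rfl⟩
    rw [hrun]
    obtain rfl : φ' = φ := (hf _ _ hφ').symm.trans hd
    exact hφ'
  · intro hφ
    let τ : ℕ → S × Set (PV ⊕ Y) × Prop := fun u =>
      (ρ u, {x | t.toLTree.Reach (t.pos x) u}, Sum.inl nil ∈ t.toLTree.label u)
    have htyp : ∀ u, (simulation nil step R φ₀ e).typ (e (τ u)) =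
        {x | t.toLTree.Reach (t.pos x) u} := fun u => by simp [simulation, τ]
    have hbelow : ∀ u, {x | t.toLTree.Reach (t.pos x) u} =
        t.toLTree.label u ∪ ⋃ v ∈ t.shape.children u, {x | t.toLTree.Reach (t.pos x) v} := by
      intro u
      ext x
      simp only [Set.mem_ofPred_eq, Set.mem_union, Set.mem_iUnion, exists_prop]
      exact t.toLTree.reach_iff
    have hdisj : ∀ u v x, v ∈ t.shape.children u → t.pos x = u → ¬ t.toLTree.Reach (t.pos x) v := by
      rintro u v x hv rfl h
      exact t.shape.acyclic _ (Relation.TransGen.tail' h (t.toLTree.mem_children.1 hv))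
    refine ⟨fun u => e (τ u), ⟨?_, ?_, ?_, ?_, ?_, ?_⟩, hf _ _ (by simpa [τ] using hφ)⟩
    · intro u hu
      refine ⟨⟨(t.shape.children u).card, Nat.lt_succ_of_le (t.card_children_le u)⟩,
        ⟨(t.shape.children u).val.map fun u => e (τ u), Multiset.card_map _ _⟩, rfl, ?_⟩
      have hM : ((t.shape.children u).val.map fun u => e (τ u)).map e.symm =
          (t.shape.children u).val.map τ := by
        simp [Multiset.map_map]
      have hs : step (((t.shape.children u).val.map τ).map Prod.fst) (t.toLTree.label u) = ρ u := by
        rw [hρ u hu, Multiset.map_map]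
        rfl
      change (simulationStep nil step R
        (Multiset.map e.symm ((t.shape.children u).val.map fun u => e (τ u)))
        (Sum.inl '' t.shape.ptrLabel u ∪ Sum.inr '' {y | t.univLabel u = some y})).map e = _
      rw [hM, ← t.label_eq, simulationStep, hs, if_neg]
      · refine congrArg some (congrArg e ?_)
        refine Prod.ext rfl (Prod.ext ?_ rfl)
        dsimp only [τ]
        rw [hbelow u]
        congr 1
        ext x; simp
      · rintro ⟨⟨c, hc, hcn⟩, hn⟩
        obtain ⟨v, hv, rfl⟩ := Multiset.mem_map.1 hc
        have hv := t.toLTree.mem_children.1 hv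
        -- A node with a child that carries `nil` is the root.
        have hd : some dirty = some u := by
          rw [← hv, ← show _ = v from hcn]
          exact t.shape.next_nil.symm
        obtain rfl := Option.some_injective _ hd
        exact hn ⟨φ, hφ⟩
    · intro u hu hc
      obtain ⟨p, hp⟩ := t.toLTree_mem.2.1 u hu hc
      refine ⟨p, ?_⟩
      rw [htyp]
      exact (show t.pos (Sum.inl p) = u from hp) ▸ .refl
    · intro u _ v hv p hp h
      rw [htyp] at h
      exact hdisj u v (Sum.inl p) hv hp h
    · intro u _ v hv y hy h
      rw [htyp] at h
      exact hdisj u v (Sum.inr y) hv (t.univLabel_eq_some.1 hy) h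
    · intro u _ _
      simp only [htyp]
      rw [hbelow u, t.label_eq]
    · rw [htyp]
      refine Set.eq_univ_of_forall fun x => t.toLTree.reach_dirty (t.toLTree.pos_mem x)

/-- A finite family of regular sets of labelled trees yields a quantified automaton which maps a
symbolic tree to the formula that a partial function `R` assigns to the members of the family to
which the tree belongs. -/
theorem exists_formulaLang_eq [Finite Y] [Nonempty F] (nil : PV) {ι : Type*} [Finite ι]
    (L : ι → Set (LTree (PV ⊕ Y))) (hL : ∀ i, Regular (L i)) (R : Set ι → F → Prop)
    (hR : ∀ X φ φ', R X φ → R X φ' → φ = φ') :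
    ∃ A : QSDA PV Y F, A.formulaLang nil = {x | R {i | x.1.toLTree ∈ L i} x.2} := by
  obtain ⟨S, _, step, out, hout⟩ := exists_det_family L hL
  obtain ⟨n, ⟨e⟩⟩ := Finite.exists_equiv_fin ((∀ i, S i) × Set (PV ⊕ Y) × Prop)
  refine ⟨simulation nil step (fun s => R (out s)) (Classical.arbitrary F) e, ?_⟩
  ext ⟨t, φ⟩
  obtain ⟨ρ, hρ⟩ := t.toLTree.exists_bottomUp (fun u m => step m (t.toLTree.label u))
  rw [mem_formulaLang_simulation nil step _ (fun s => hR (out s)) _ e t φ ρ fun u _ => hρ u]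
  rw [← hout t.toLTree ρ fun u _ => hρ u]
  rfl

end

/-! ### Regularity of the images under structural updates -/

section

variable {PV Y D F : Type*} {nil : PV}

open LTree

/-- Garbage collection is the deletion of unlabelled subtrees. -/
theorem SymTree.collects_iff_sub (t : SymTree PV nil Y) (B : LTree (PV ⊕ Y))
    (h : t.pos = B.pos) : t.shape.Collects B.next ↔ t.toLTree.Sub B := by
  constructor
  · rintro ⟨h1, h2⟩
    refine ⟨fun u hu => ?_, h2, h⟩
    obtain ⟨p, hp⟩ := (h1 u).1 hu
    refine B.reach_mem ?_ hp
    rw [show t.shape.pval p = B.pos (Sum.inl p) from congrFun h (Sum.inl p)]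
    exact B.pos_mem _
  · rintro ⟨_, h2, _⟩
    refine ⟨fun u => ⟨fun hu => ?_, ?_⟩, h2⟩
    · obtain ⟨p, hp⟩ := t.shape.reachable u hu
      refine ⟨p, Relation.ReflTransGen.mono (fun a b hab => ?_) _ _ hp⟩
      rw [← h2 a (t.toLTree.mem_loc_of_next hab)]
      exact hab
    · rintro ⟨p, hp⟩
      induction hp with
      | refl => exact t.shape.pval_mem p
      | tail _ hab ih => exact t.shape.next_mem _ _ ((h2 _ ih).trans hab)

open Classical in
/-- The renaming of variables that reads the old position of `p` from the additional variable. -/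
noncomputable def oldVar (p : PV) : PV ⊕ Y → Option (PV ⊕ Y)
  | .inl q => if q = p then none else some (.inl q)
  | .inr y => some (.inr y)

/-- Assignments to the pointer variable `p`. The condition `Q` relates the old tree to the new
location of `p`. The old position of `p` is quantified existentially, and what only `p` kept
alive is deleted. -/
theorem exists_regular_assign {M : Set (LTree (PV ⊕ Y))} (hM : Regular M)
    (hMs : M ⊆ symTrees nil) (p : PV) (Q : LTree (PV ⊕ Y) → ℕ → Prop)
    (hQ : Regular {B : LTree (Option (PV ⊕ Y)) |
      Q (B.comap (oldVar p)) (B.pos (some (Sum.inl p)))})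
    (hmem : ∀ G x, Q G x → x ∈ G.loc) :
    ∃ L, Regular L ∧ ∀ t' : SymTree PV nil Y, t'.toLTree ∈ L ↔
      ∃ t : SymTree PV nil Y, t.toLTree ∈ M ∧ Q t.toLTree (t'.shape.pval p) ∧
        (∀ q, q ≠ p → t'.shape.pval q = t.shape.pval q) ∧ t'.shape.Collects t.shape.next ∧
        ∀ y, t'.val y = t.val y := by
  refine ⟨_, ((hM.comap (oldVar p)).inter hQ).image_comap_some.prune, fun t' => ⟨?_, ?_⟩⟩
  · rintro ⟨_, ⟨B, ⟨hB, hBQ⟩, rfl⟩, hsub⟩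
    obtain ⟨t, ht⟩ := exists_symTree (hMs hB)
    have hpos : ∀ v, t'.pos v = B.pos (some v) := fun v => congrFun hsub.2.2 v
    have hold : ∀ v, t.pos v = B.pos (oldVar p v) := fun v =>
      congrFun (congrArg LTree.pos ht) v
    refine ⟨t, ht ▸ hB, ?_, fun q hq => ?_, ?_, fun y => ?_⟩
    · rw [show t'.shape.pval p = _ from hpos (Sum.inl p), ht]
      exact hBQ
    · refine (hpos (Sum.inl q)).trans ((hold (Sum.inl q)).trans ?_).symm
      simp [oldVar, hq]
    · rw [show t.shape.next = B.next from congrArg (fun G => G.next) ht]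
      exact (t'.collects_iff_sub (B.comap some) hsub.2.2).2 hsub
    · exact (hpos (Sum.inr y)).trans (hold (Sum.inr y)).symm
  · rintro ⟨t, ht, hQt, hp, hcol, hval⟩
    let B : LTree (Option (PV ⊕ Y)) :=
      { toRTree := t.shape.toRTree
        pos := fun v => v.elim (t.shape.pval p) t'.pos
        pos_mem := by
          rintro (_ | q | y)
          · exact t.shape.pval_mem p
          · by_cases hq : q = p
            · exact hq ▸ hmem _ _ hQt
            · change t'.shape.pval q ∈ t.shape.loc
              exact hp q hq ▸ t.shape.pval_mem q
          · change t'.val y ∈ t.shape.loc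
            exact hval y ▸ t.val_mem y }
    have hB : B.comap (oldVar p) = t.toLTree := by
      ext v
      · rfl
      · rfl
      · rcases v with q | y
        · by_cases hq : q = p
          · subst hq
            simp [B, LTree.comap, oldVar, SymTree.toLTree, SymTree.pos]
          · simpa [B, LTree.comap, oldVar, SymTree.toLTree, SymTree.pos, hq] using hp q hq
        · exact hval y
    refine ⟨_, ⟨B, ⟨?_, ?_⟩, rfl⟩, (t'.collects_iff_sub (B.comap some) rfl).1 hcol⟩
    · change B.comap (oldVar p) ∈ M
      exact hB ▸ ht
    · change Q (B.comap (oldVar p)) _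
      exact hB ▸ hQt

/-- Assignments to the `next` field of `p`. An additional variable marks the old target of the edge,
so that the old tree is recovered by redirecting the edge. -/
theorem exists_regular_setNext [Finite PV] [Finite Y] {M : Set (LTree (PV ⊕ Y))} (hM : Regular M)
    (hMs : M ⊆ symTrees nil) (p q : PV) :
    ∃ L, Regular L ∧ ∀ t' : SymTree PV nil Y, t'.toLTree ∈ L ↔
      ∃ t : SymTree PV nil Y, t.toLTree ∈ M ∧ Update t (Stmt.setNext p q : Stmt PV nil D) t' := by
  let P : Option (PV ⊕ Y) := some (.inl p)
  let P' : Option (PV ⊕ Y) := some (.inl q)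
  let N : Option (PV ⊕ Y) := some (.inl nil)
  refine ⟨_, ((((hM.comap some).reattach P none).inter
    ((regular_next P P').inter ((regular_dirty P).compl.inter
      (regular_eq P N).compl))).image_comap_some.prune), fun t' => ⟨?_, ?_⟩⟩
  · rintro ⟨_, ⟨B, ⟨⟨G₀, hG₀, hr⟩, hnext, hd, hnil⟩, rfl⟩, hsub⟩
    obtain ⟨t, ht⟩ := exists_symTree (hMs hG₀)
    have hpos : ∀ v, t'.pos v = B.pos (some v) := fun v => congrFun hsub.2.2 v
    have hold : ∀ v, t.pos v = B.pos (some v) := fun v =>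
      (congrFun (congrArg LTree.pos ht) v).trans (congrFun hr.2.2 (some v))
    have htn : t.shape.next = G₀.next := congrArg (fun G => G.next) ht
    have hBn : Function.update t.shape.next (t.shape.pval p) (some (t.shape.pval q)) =
        B.next := by
      rw [htn, hr.2.1, show t.shape.pval p = _ from hold (Sum.inl p),
        show t.shape.pval q = _ from hold (Sum.inl q), Function.update_idem]
      exact Function.update_eq_self_iff.2 hnext.symm
    refine ⟨t, ht ▸ hG₀, ⟨⟨?_, ?_⟩, funext fun r => ?_, ?_⟩, fun y => ?_⟩
    · rw [show t.shape.pval p = _ from hold (Sum.inl p)]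
      exact hd
    · rw [show t.shape.pval p = _ from hold (Sum.inl p),
        show t.shape.pval nil = _ from hold (Sum.inl nil)]
      exact hnil
    · exact (hpos (Sum.inl r)).trans (hold (Sum.inl r)).symm
    · rw [hBn]
      exact (t'.collects_iff_sub (B.comap some) hsub.2.2).2 hsub
    · exact (hpos (Sum.inr y)).trans (hold (Sum.inr y)).symm
  · rintro ⟨t, ht, ⟨⟨hd, hnil⟩, hpval, hcol⟩, hval⟩
    obtain ⟨w, hw⟩ := t.shape.next_defined _ (t.shape.pval_mem p) hd
    let G₀ : LTree (Option (PV ⊕ Y)) := t.toLTree.extend w (t.shape.next_mem _ _ hw)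
    have hcol' : ∀ u ∈ t'.shape.loc, t'.shape.next u =
      Function.update t.shape.next (t.shape.pval p) (some (t.shape.pval q)) u := hcol.2
    have hx : t'.shape.next (t.shape.pval p) = some (t.shape.pval q) := by
      rw [hcol' _ (hpval ▸ t'.shape.pval_mem p), Function.update_self]
    -- Otherwise the updated heap would have a cycle.
    have hnr : ¬ G₀.Reach (G₀.pos P') (G₀.pos P) := by
      intro h
      have key : ∀ y, G₀.Reach y (t.shape.pval p) → y ∈ t'.shape.loc →
          t'.toLTree.Reach y (t.shape.pval p) := by
        intro y hy
        induction hy using Relation.ReflTransGen.head_induction_on with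
        | refl => exact fun _ => .refl
        | @head y z hyz _ ih =>
          intro hyl
          by_cases hyp : y = t.shape.pval p
          · exact hyp ▸ .refl
          · have h1 : t'.shape.next y = some z := by
              rw [hcol' y hyl, Function.update_of_ne hyp]
              exact hyz
            exact .head h1 (ih (t'.shape.next_mem _ _ h1))
      have h1 := key _ h ((show G₀.pos P' = _ from (congrFun hpval q).symm) ▸ t'.shape.pval_mem q)
      exact t'.shape.acyclic _ (Relation.TransGen.head' hx h1)
    refine ⟨_, ⟨G₀.reattach P P' hnr, ⟨⟨G₀, ?_, ?_⟩, ?_, hd, hnil⟩, rfl⟩, ?_⟩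
    · exact ht
    · refine ⟨rfl, ?_, rfl⟩
      change t.shape.next = Function.update (Function.update t.shape.next (t.shape.pval p) _)
        (t.shape.pval p) (some w)
      rw [Function.update_idem]
      exact (Function.update_eq_self_iff.2 hw.symm).symm
    · change Function.update t.shape.next (t.shape.pval p) _ (t.shape.pval p) = _
      rw [Function.update_self]
      rfl
    · refine (t'.collects_iff_sub ((G₀.reattach P P' hnr).comap some) ?_).1 hcol
      ext v
      rcases v with r | y
      · exact congrFun hpval r
      · exact hval y

open Classical in
/-- The renaming of variables that reads the old positions of `p` and `y` from two additional
variables and takes the new position of `p` as the position of the new location. -/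
noncomputable def newVar (p : PV) (y : Option Y) : Option (PV ⊕ Y) → Option (Option (PV ⊕ Y))
  | none => some (some (.inl p))
  | some (.inl q) => if q = p then none else some (some (.inl q))
  | some (.inr z) => if y = some z then some none else some (some (.inr z))

/-- Allocation. The old positions of `p` and of the universal variable `y` on the new location are
quantified existentially, and the old tree is recovered by removing the new leaf. -/
theorem exists_regular_new [Finite PV] [Finite Y] {M : Set (LTree (PV ⊕ Y))} (hM : Regular M)
    (hMs : M ⊆ symTrees nil) (p : PV) (hp : p ≠ nil) (y : Option Y) :
    ∃ L, Regular L ∧ ∀ t' : SymTree PV nil Y, t'.toLTree ∈ L ↔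
      ∃ t : SymTree PV nil Y, t.toLTree ∈ M ∧
        UpdateNew t (Stmt.new p hp : Stmt PV nil D) p y t' := by
  classical
  let P : Option (Option (PV ⊕ Y)) := some (some (.inl p))
  have hy : Regular {B : LTree (Option (Option (PV ⊕ Y))) |
      ∀ z, y = some z → B.pos (some (some (.inr z))) = B.pos P} := by
    cases y with
    | none =>
      convert regular_univ using 1
      ext B
      simp
    | some z =>
      convert regular_eq (some (some (.inr z))) P using 1
      ext B
      simp
  refine ⟨_, (((hM.remove.comap (newVar p y)).inter
    ((regular_next_dirty P).inter hy)).image_comap_some.image_comap_some.prune),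
    fun t' => ⟨?_, ?_⟩⟩
  · rintro ⟨_, ⟨_, ⟨B, ⟨⟨G₀, hG₀, hr⟩, hnext, hBy⟩, rfl⟩, rfl⟩, hsub⟩
    obtain ⟨t, ht⟩ := exists_symTree (hMs hG₀)
    have hpos : ∀ v, t'.pos v = B.pos (some (some v)) := fun v => congrFun hsub.2.2 v
    have hold : ∀ v, t.pos v = B.pos (newVar p y (some v)) := fun v =>
      (congrFun (congrArg LTree.pos ht) v).trans (hr.2.2.2 v).symm
    have htn : t.shape.next = G₀.next := congrArg (fun G => G.next) ht
    have htl : t.shape.loc = G₀.loc := congrArg (fun G => G.loc) ht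
    have hx : t'.shape.pval p = B.pos P := hpos (Sum.inl p)
    have hxl : B.pos P ∉ G₀.loc := hr.1
    have hBn : Function.update t.shape.next (t'.shape.pval p) (some dirty) = B.next := by
      funext u
      rw [hx]
      by_cases hu : u = B.pos P
      · subst hu
        rw [Function.update_self]
        exact hnext.symm
      · rw [Function.update_of_ne hu, htn]
        by_cases hul : u ∈ G₀.loc
        · exact (hr.2.2.1 u hul).symm
        · rw [G₀.next_outside u hul, B.next_outside u]
          intro hu'
          have h2 : B.loc = insert (B.pos P) G₀.loc := hr.2.1
          rw [h2, Finset.mem_insert] at hu'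
          exact hu'.elim hu hul
    refine ⟨t, ht ▸ hG₀, ⟨?_, fun q hq => ?_, ?_⟩, fun z hz => ?_, fun z hz => ?_⟩
    · rw [hx, htl]
      exact hxl
    · refine (hpos (Sum.inl q)).trans ((hold (Sum.inl q)).trans ?_).symm
      simp [newVar, hq]
    · rw [hBn]
      exact (t'.collects_iff_sub ((B.comap some).comap some) hsub.2.2).2 hsub
    · exact (hpos (Sum.inr z)).trans ((hBy z hz).trans hx.symm)
    · refine (hpos (Sum.inr z)).trans ((hold (Sum.inr z)).trans ?_).symm
      simp [newVar, hz]
  · rintro ⟨t, ht, ⟨hx, hq, hcol⟩, hz, hz'⟩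
    let T : RTree := (t.toLTree.addLeaf (t'.shape.pval p) dirty hx t.shape.dirty_mem).toRTree
    have hT : ∀ u ∈ t.shape.loc, u ∈ T.loc := fun u hu => Finset.mem_insert_of_mem hu
    have hxT : t'.shape.pval p ∈ T.loc := Finset.mem_insert_self _ _
    let B : LTree (Option (Option (PV ⊕ Y))) :=
      { toRTree := T
        pos := fun v => v.elim (t.shape.pval p) fun v => v.elim (y.elim dirty t.val) t'.pos
        pos_mem := by
          rintro (_ | _ | q | z)
          · exact hT _ (t.shape.pval_mem p)
          · cases y with
            | none => exact hT _ t.shape.dirty_mem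
            | some y => exact hT _ (t.val_mem y)
          · by_cases h : q = p
            · exact h ▸ hxT
            · change t'.shape.pval q ∈ T.loc
              exact hq q h ▸ hT _ (t.shape.pval_mem q)
          · by_cases h : y = some z
            · change t'.val z ∈ T.loc
              exact hz z h ▸ hxT
            · change t'.val z ∈ T.loc
              exact hz' z h ▸ hT _ (t.val_mem z) }
    have hBn : B.next = Function.update t.shape.next (t'.shape.pval p) (some dirty) := rfl
    refine ⟨_, ⟨_, ⟨B, ⟨⟨t.toLTree, ht, hx, rfl, fun u hu => ?_, fun v => ?_⟩, ?_, ?_⟩, rfl⟩, rfl⟩,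
      (t'.collects_iff_sub ((B.comap some).comap some) rfl).1 hcol⟩
    · change B.next u = _
      rw [hBn, Function.update_of_ne]
      · rfl
      · rintro rfl
        exact hx hu
    · rcases v with q | z
      · by_cases h : q = p
        · subst h
          simp [B, LTree.comap, newVar, SymTree.toLTree, SymTree.pos]
        · simpa [B, LTree.comap, newVar, SymTree.toLTree, SymTree.pos, h] using hq q h
      · by_cases h : y = some z
        · subst h
          simp [B, LTree.comap, newVar, SymTree.toLTree, SymTree.pos]
        · simpa [B, LTree.comap, newVar, SymTree.toLTree, SymTree.pos, h] using hz' z h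
    · change B.next (t'.shape.pval p) = some dirty
      rw [hBn, Function.update_self]
    · exact fun z h => hz z h

end

/-! ### The abstract transformer is computed by an automaton -/

section

variable {PV Y D F : Type*} {nil : PV}

theorem exists_regular_holds [Finite PV] [Finite Y] (nil : PV) (ψ : StructPred PV) :
    ∃ L, Regular L ∧ ∀ t : SymTree PV nil Y, t.toLTree ∈ L ↔ ψ.Holds t.shape := by
  induction ψ with
  | eq p q => exact ⟨_, regular_eq (.inl p) (.inl q), fun t => Iff.rfl⟩
  | nextEq p q => exact ⟨_, regular_next (.inl p) (.inl q), fun t => Iff.rfl⟩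
  | reach p q => exact ⟨_, regular_reach (.inl p) (.inl q), fun t => Iff.rfl⟩
  | not ψ ih =>
    obtain ⟨L, hL, h⟩ := ih
    exact ⟨_, hL.compl, fun t => not_congr (h t)⟩
  | and ψ₁ ψ₂ ih₁ ih₂ =>
    obtain ⟨L₁, hL₁, h₁⟩ := ih₁
    obtain ⟨L₂, hL₂, h₂⟩ := ih₂
    exact ⟨_, hL₁.inter hL₂, fun t => and_congr (h₁ t) (h₂ t)⟩
  | or ψ₁ ψ₂ ih₁ ih₂ =>
    obtain ⟨L₁, hL₁, h₁⟩ := ih₁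
    obtain ⟨L₂, hL₂, h₂⟩ := ih₂
    exact ⟨_, hL₁.union hL₂, fun t => or_congr (h₁ t) (h₂ t)⟩

theorem exists_regular_update_assign [Finite PV] [Finite Y] {M : Set (LTree (PV ⊕ Y))}
    (hM : Regular M) (hMs : M ⊆ symTrees nil) (p q : PV) (hp : p ≠ nil) :
    ∃ L, Regular L ∧ ∀ t' : SymTree PV nil Y, t'.toLTree ∈ L ↔
      ∃ t : SymTree PV nil Y, t.toLTree ∈ M ∧
        Update t (Stmt.assign p q hp : Stmt PV nil D) t' := by
  obtain ⟨L, hL, h⟩ := exists_regular_assign hM hMs p (fun G x => x = G.pos (Sum.inl q))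
    (regular_eq _ _) (by rintro G _ rfl; exact G.pos_mem _)
  refine ⟨L, hL, fun t' => (h t').trans (exists_congr fun t => and_congr_right fun _ => ?_)⟩
  exact ⟨fun h => ⟨⟨h.1, h.2.1, h.2.2.1⟩, h.2.2.2⟩, fun h => ⟨h.1.1, h.1.2.1, h.1.2.2, h.2⟩⟩

theorem exists_regular_update_assignNext [Finite PV] [Finite Y] {M : Set (LTree (PV ⊕ Y))}
    (hM : Regular M) (hMs : M ⊆ symTrees nil) (p q : PV) (hp : p ≠ nil) :
    ∃ L, Regular L ∧ ∀ t' : SymTree PV nil Y, t'.toLTree ∈ L ↔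
      ∃ t : SymTree PV nil Y, t.toLTree ∈ M ∧
        Update t (Stmt.assignNext p q hp : Stmt PV nil D) t' := by
  obtain ⟨L, hL, h⟩ := exists_regular_assign hM hMs p
    (fun G x => (G.pos (Sum.inl q) ≠ dirty ∧ G.pos (Sum.inl q) ≠ G.pos (Sum.inl nil)) ∧
      G.next (G.pos (Sum.inl q)) = some x)
    (((regular_dirty _).compl.inter (regular_eq _ _).compl).inter (regular_next _ _))
    (fun G _ hx => G.next_mem _ _ hx.2)
  refine ⟨L, hL, fun t' => (h t').trans (exists_congr fun t => and_congr_right fun _ => ?_)⟩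
  exact ⟨fun h => ⟨⟨h.1.1, h.1.2, h.2.1, h.2.2.1⟩, h.2.2.2⟩,
    fun h => ⟨⟨h.1.1, h.1.2.1⟩, h.1.2.2.1, h.1.2.2.2, h.2⟩⟩

end

section

variable {PV Y F : Type*} {nil : PV} [Fintype PV]

theorem QSDA.runLang_subset (A : QSDA PV Y F) (q : Fin A.n) :
    A.runLang nil q ⊆ symTrees nil := by
  rintro _ ⟨t, rfl, _⟩
  exact t.toLTree_mem

theorem QSDA.mem_formulaLang (A : QSDA PV Y F) {t : SymTree PV nil Y} {φ : F} :
    (t, φ) ∈ A.formulaLang nil ↔ ∃ q, t.toLTree ∈ A.runLang nil q ∧ A.f q = φ := by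
  simp only [A.mem_runLang]
  constructor
  · rintro ⟨ρ, hρ, h⟩
    exact ⟨_, ⟨ρ, hρ, rfl⟩, h⟩
  · rintro ⟨_, ⟨ρ, hρ, rfl⟩, h⟩
    exact ⟨ρ, hρ, h⟩

theorem QSDA.formula_unique (A : QSDA PV Y F) {t : SymTree PV nil Y} {φ φ' : F}
    (h : (t, φ) ∈ A.formulaLang nil) (h' : (t, φ') ∈ A.formulaLang nil) : φ = φ' := by
  obtain ⟨ρ, hρ, hφ⟩ := h
  obtain ⟨ρ', hρ', hφ'⟩ := h'
  exact hφ.symm.trans ((congrArg A.f (hρ.unique hρ')).trans hφ')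

/-- The formulas of the predecessors of a symbolic tree are those of finitely many root states. -/
theorem QSDA.exists_formula_iff (A : QSDA PV Y F) {L : Fin A.n → Set (LTree (PV ⊕ Y))}
    {U : SymTree PV nil Y → Prop} {t' : SymTree PV nil Y}
    (hL : ∀ q, t'.toLTree ∈ L q ↔ ∃ t : SymTree PV nil Y, t.toLTree ∈ A.runLang nil q ∧ U t)
    (Ψ : F → Prop) :
    (∃ t φ, (t, φ) ∈ A.formulaLang nil ∧ U t ∧ Ψ φ) ↔
      ∃ q ∈ {q | t'.toLTree ∈ L q}, Ψ (A.f q) := by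
  constructor
  · rintro ⟨t, φ, hφ, hU, hΨ⟩
    obtain ⟨q, hq, rfl⟩ := A.mem_formulaLang.1 hφ
    exact ⟨q, (hL q).2 ⟨t, hq, hU⟩, hΨ⟩
  · rintro ⟨q, hq, hΨ⟩
    obtain ⟨t, ht, hU⟩ := (hL q).1 hq
    exact ⟨t, _, A.mem_formulaLang.2 ⟨q, ht, rfl⟩, hU, hΨ⟩

/-- A version of `exists_formulaLang_eq` in which the formula also depends on the label of `p`. -/
theorem exists_formulaLang_eq_label [Finite Y] [Nonempty F] {ι : Type*} [Finite ι] (p : PV)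
    (L : ι → Set (LTree (PV ⊕ Y))) (hL : ∀ i, Regular (L i))
    (R : Set ι → Set (PV ⊕ Y) → F → Prop) (hR : ∀ X l φ φ', R X l φ → R X l φ' → φ = φ') :
    ∃ A : QSDA PV Y F,
      A.formulaLang nil = {x | R {i | x.1.toLTree ∈ L i} (x.1.label p) x.2} := by
  obtain ⟨A, hA⟩ := exists_formulaLang_eq (F := F) nil (ι := ι ⊕ Set (PV ⊕ Y))
    (Sum.elim L fun l => {G | G.label (G.pos (Sum.inl p)) = l})
    (by rintro (i | l); exacts [hL i, regular_label _ _])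
    (fun X φ => ∃ l, {l' | Sum.inr l' ∈ X} = {l} ∧ R {i | Sum.inl i ∈ X} l φ)
    (by
      rintro X φ φ' ⟨l, hl, h⟩ ⟨l', hl', h'⟩
      obtain rfl : l = l' := Set.singleton_injective (hl.symm.trans hl')
      exact hR _ _ _ _ h h')
  refine ⟨A, hA.trans ?_⟩
  ext x
  constructor
  · rintro ⟨l, hl, h⟩
    obtain rfl : x.1.label p = l := by
      have : x.1.label p ∈ ({l} : Set (Set (PV ⊕ Y))) := by
        rw [← hl]
        rfl
      exact this
    exact h
  · intro h
    refine ⟨x.1.label p, ?_, h⟩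
    ext l
    exact eq_comm

/-- Restrict the symbolic trees to a regular set and rewrite their formulas by a partial function
that depends on the label of `p`. -/
theorem QSDA.exists_formulaLang_map [Finite Y] [Nonempty F] (A : QSDA PV Y F) (p : PV)
    {H : Set (LTree (PV ⊕ Y))} (hH : Regular H) (R : Set (PV ⊕ Y) → F → F → Prop)
    (hR : ∀ l φ ψ ψ', R l φ ψ → R l φ ψ' → ψ = ψ') :
    ∃ A' : QSDA PV Y F, A'.formulaLang nil = {x | ∃ φ, (x.1, φ) ∈ A.formulaLang nil ∧
      x.1.toLTree ∈ H ∧ R (x.1.label p) φ x.2} := by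
  -- Since `A` is deterministic, the formulas of the possible root states form a subsingleton; this
  -- condition makes the output a partial function of an arbitrary set of root states.
  obtain ⟨A', hA'⟩ := exists_formulaLang_eq_label (nil := nil) p
    (fun q => A.runLang nil q ∩ H) (fun q => (A.regular_runLang q).inter hH)
    (fun X l ψ => (A.f '' X).Subsingleton ∧ ∃ q ∈ X, R l (A.f q) ψ)
    (by
      rintro X l _ _ ⟨hX, q, hq, h⟩ ⟨_, q', hq', h'⟩
      rw [hX ⟨q, hq, rfl⟩ ⟨q', hq', rfl⟩] at h
      exact hR _ _ _ _ h h')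
  refine ⟨A', hA'.trans ?_⟩
  ext ⟨t, ψ⟩
  constructor
  · rintro ⟨_, q, hq, h⟩
    exact ⟨_, A.mem_formulaLang.2 ⟨q, hq.1, rfl⟩, hq.2, h⟩
  · rintro ⟨φ, hφ, hH, h⟩
    obtain ⟨q, hq, rfl⟩ := A.mem_formulaLang.1 hφ
    refine ⟨?_, q, ⟨hq, hH⟩, h⟩
    rintro _ ⟨q₁, hq₁, rfl⟩ _ ⟨q₂, hq₂, rfl⟩
    exact A.formula_unique (A.mem_formulaLang.2 ⟨q₁, hq₁.1, rfl⟩)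
      (A.mem_formulaLang.2 ⟨q₂, hq₂.1, rfl⟩)

end

theorem FormulaDomain.eq_of_iff {V D F : Type*} [Lattice F] [BoundedOrder F]
    (𝓕 : FormulaDomain V D F) {P : (V → D) → Prop}
    {φ φ' : F} (h : ∀ r, 𝓕.Sat φ r ↔ P r) (h' : ∀ r, 𝓕.Sat φ' r ↔ P r) : φ = φ' :=
  𝓕.inequivalent _ _ fun r => (h r).trans (h' r).symm

section

variable {PV Y D F : Type*} {nil : PV} [Fintype PV] [Lattice F] [BoundedOrder F]

theorem exists_formulaLang_setNext [Finite Y] (𝓕 : FormulaDomain (PV ⊕ Y) D F) (p q : PV)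
    (A : QSDA PV Y F) :
    ∃ A' : QSDA PV Y F,
      A'.formulaLang nil = formulaPost 𝓕 (Stmt.setNext p q) (A.formulaLang nil) := by
  have : Nonempty F := ⟨⊥⟩
  choose L hL h using fun i => exists_regular_setNext (D := D)
    (A.regular_runLang (nil := nil) i) (A.runLang_subset i) p q
  obtain ⟨A', hA'⟩ := exists_formulaLang_eq_label (nil := nil) p L hL
    (fun X _ φ' => IsLUB {ψ | ∃ q ∈ X, A.f q = ψ} φ') (fun _ _ _ _ => IsLUB.unique)
  refine ⟨A', hA'.trans ?_⟩
  ext x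
  simp only [formulaPost]
  refine iff_of_eq (congrArg (IsLUB · x.2) (Set.ext fun ψ => ?_))
  refine (A.exists_formula_iff (fun q => h q x.1) (· = ψ)).symm.trans (exists_congr fun t => ?_)
  exact ⟨fun ⟨φ, h, h', e⟩ => e ▸ ⟨h, h'⟩, fun ⟨h, h'⟩ => ⟨_, h, h', rfl⟩⟩

theorem exists_formulaLang_eq_formulaPost [Finite Y] (𝓕 : FormulaDomain (PV ⊕ Y) D F)
    (s : Stmt PV nil D) (A : QSDA PV Y F) :
    ∃ A' : QSDA PV Y F, A'.formulaLang nil = formulaPost 𝓕 s (A.formulaLang nil) := by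
  have : Nonempty F := ⟨⊥⟩
  cases s with
  | assignNil p hp =>
    choose L hL h using fun q => exists_regular_update_assign (D := D)
      (A.regular_runLang (nil := nil) q)
      (A.runLang_subset q) p nil hp
    obtain ⟨A', hA'⟩ := exists_formulaLang_eq_label (nil := nil) p L hL
      (fun X _ φ' => IsLUB {ψ | ∃ q ∈ X, 𝓕.IsEx (Sum.inl p) (A.f q) ψ} φ')
      (fun _ _ _ _ => IsLUB.unique)
    refine ⟨A', hA'.trans ?_⟩
    ext x
    simp only [formulaPost]
    refine iff_of_eq (congrArg (IsLUB · x.2) (Set.ext fun ψ => ?_))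
    exact (A.exists_formula_iff (fun q => h q x.1) fun φ => 𝓕.IsEx (Sum.inl p) φ ψ).symm
  | assign p q hp =>
    choose L hL h using fun i => exists_regular_update_assign (D := D)
      (A.regular_runLang (nil := nil) i)
      (A.runLang_subset i) p q hp
    obtain ⟨A', hA'⟩ := exists_formulaLang_eq_label (nil := nil) p L hL
      (fun X _ φ' => ∃ χ ε, IsLUB {ψ | ∃ q ∈ X, 𝓕.IsEx (Sum.inl p) (A.f q) ψ} χ ∧
        𝓕.IsEq (Sum.inl p) (Sum.inl q) ε ∧ φ' = ε ⊓ χ)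
      (by
        rintro _ _ _ _ ⟨χ, ε, h, h', rfl⟩ ⟨χ', ε', h₁, h₁', rfl⟩
        rw [h.unique h₁, 𝓕.eq_of_iff h' h₁'])
    refine ⟨A', hA'.trans ?_⟩
    ext x
    simp only [formulaPost]
    refine exists_congr fun χ => exists_congr fun ε => and_congr ?_ Iff.rfl
    refine iff_of_eq (congrArg (IsLUB · χ) (Set.ext fun ψ => ?_))
    exact (A.exists_formula_iff (fun q => h q x.1) fun φ => 𝓕.IsEx (Sum.inl p) φ ψ).symm
  | assignNext p q hp =>
    choose L hL h using fun i => exists_regular_update_assignNext (D := D)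
      (A.regular_runLang (nil := nil) i)
      (A.runLang_subset i) p q hp
    obtain ⟨A', hA'⟩ := exists_formulaLang_eq_label (nil := nil) p L hL
      (fun X l φ' => ∃ χ, IsLUB {ψ | ∃ q ∈ X, 𝓕.IsEx (Sum.inl p) (A.f q) ψ} χ ∧
        IsGLB (insert χ {ε | ∃ v ∈ l, 𝓕.IsEq (Sum.inl p) v ε}) φ')
      (by
        rintro _ _ _ _ ⟨χ, h, h'⟩ ⟨χ', h₁, h₁'⟩
        obtain rfl := h.unique h₁
        exact h'.unique h₁')
    refine ⟨A', hA'.trans ?_⟩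
    ext x
    simp only [formulaPost]
    refine exists_congr fun χ => and_congr ?_ Iff.rfl
    refine iff_of_eq (congrArg (IsLUB · χ) (Set.ext fun ψ => ?_))
    exact (A.exists_formula_iff (fun q => h q x.1) fun φ => 𝓕.IsEx (Sum.inl p) φ ψ).symm
  | setNextNil p => exact exists_formulaLang_setNext 𝓕 p nil A
  | setNext p q => exact exists_formulaLang_setNext 𝓕 p q A
  | setData p e =>
    obtain ⟨A', hA'⟩ := A.exists_formulaLang_map (nil := nil) p regular_univ
      (fun l φ ψ => 𝓕.IsStore l e φ ψ) (fun _ _ _ _ => 𝓕.eq_of_iff)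
    refine ⟨A', hA'.trans ?_⟩
    ext x
    simp [formulaPost]
  | assumeStruct P =>
    obtain ⟨H, hH, hP⟩ := exists_regular_holds (Y := Y) nil P
    obtain ⟨A', hA'⟩ := A.exists_formulaLang_map (nil := nil) nil hH
      (fun _ φ ψ => φ = ψ) (fun _ _ _ _ h h' => h.symm.trans h')
    refine ⟨A', hA'.trans ?_⟩
    ext ⟨t, φ⟩
    simp only [formulaPost]
    constructor
    · rintro ⟨_, h, h', rfl⟩
      exact ⟨h, (hP t).1 h'⟩
    · exact fun h => ⟨φ, h.1, (hP t).2 h.2, rfl⟩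
  | assumeData P =>
    obtain ⟨A', hA'⟩ := A.exists_formulaLang_map (nil := nil) nil regular_univ
      (fun _ φ ψ => ∃ c, 𝓕.IsPred P c ∧ ψ = φ ⊓ c) (by
        rintro _ φ _ _ ⟨c, hc, rfl⟩ ⟨c', hc', rfl⟩
        rw [𝓕.eq_of_iff hc hc'])
    refine ⟨A', hA'.trans ?_⟩
    ext x
    simp [formulaPost]
  | new p hp =>
    choose L hL h using fun i : Option Y × Fin A.n => exists_regular_new (D := D)
      (A.regular_runLang (nil := nil) i.2) (A.runLang_subset i.2) p hp i.1
    obtain ⟨A', hA'⟩ := exists_formulaLang_eq_label (nil := nil) p L hL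
      (fun X l φ' => match univOf l with
        | none => IsLUB {ψ | ∃ q ∈ {q | (none, q) ∈ X}, 𝓕.IsEx (Sum.inl p) (A.f q) ψ} φ'
        | some y => ∃ χ ε, IsLUB {ψ | ∃ q ∈ {q | (some y, q) ∈ X}, ∃ θ,
            𝓕.IsEx (Sum.inl p) (A.f q) θ ∧ 𝓕.IsEx (Sum.inr y) θ ψ} χ ∧
            𝓕.IsEq (Sum.inr y) (Sum.inl p) ε ∧ φ' = ε ⊓ χ)
      (by
        intro X l φ φ'
        split
        · exact IsLUB.unique
        · rintro ⟨χ, ε, h, h', rfl⟩ ⟨χ', ε', h₁, h₁', rfl⟩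
          rw [h.unique h₁, 𝓕.eq_of_iff h' h₁'])
    refine ⟨A', hA'.trans ?_⟩
    ext ⟨t', φ'⟩
    have hu : t'.univLabel (t'.shape.pval p) = univOf (t'.label p) := rfl
    simp only [formulaPost, Set.mem_ofPred_eq, hu]
    cases univOf (t'.label p) with
    | none =>
      refine iff_of_eq (congrArg (IsLUB · φ') (Set.ext fun ψ => ?_))
      exact (A.exists_formula_iff (L := fun q => L (none, q)) (fun q => h (none, q) t')
        fun φ => 𝓕.IsEx (Sum.inl p) φ ψ).symm
    | some y =>
      refine exists_congr fun χ => exists_congr fun ε => and_congr ?_ Iff.rfl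
      refine iff_of_eq (congrArg (IsLUB · χ) (Set.ext fun ψ => ?_))
      refine (A.exists_formula_iff (L := fun q => L (some y, q))
        (U := fun t => UpdateNew t (Stmt.new p hp) p (some y) t') (fun q => h (some y, q) t')
        fun φ => ∃ θ, 𝓕.IsEx (Sum.inl p) φ θ ∧ 𝓕.IsEx (Sum.inr y) θ ψ).symm.trans ?_
      refine exists_congr fun t => exists_congr fun φ => ?_
      exact ⟨fun ⟨h, h', θ, hθ⟩ => ⟨θ, h, h', hθ⟩, fun ⟨θ, h, h', hθ⟩ => ⟨h, h', θ, hθ⟩⟩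

end

/-! ### Soundness -/

section

variable {PV D : Type*} {nil : PV}

theorem Shape.Collects.loc_subset {nx : ℕ → Option ℕ} {σ : Shape PV nil} (h : σ.Collects nx)
    {S : Finset ℕ} (hp : ∀ p, σ.pval p ∈ S) (hnx : ∀ a b, nx a = some b → b ∈ S) :
    σ.loc ⊆ S := by
  intro u hu
  obtain ⟨p, hpu⟩ := (h.1 u).1 hu
  rcases Relation.ReflTransGen.cases_tail hpu with rfl | ⟨a, _, ha⟩
  · exact hp p
  · exact hnx _ _ ha

end

section

variable {V D F : Type*} [Lattice F] [BoundedOrder F]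

theorem exists_isLUB_of_finite {S : Set F} (hS : S.Finite) : ∃ χ, IsLUB S χ :=
  ⟨_, by simpa using hS.toFinset.isLUB_sup_id⟩

theorem exists_isGLB_of_finite {S : Set F} (hS : S.Finite) : ∃ χ, IsGLB S χ :=
  ⟨_, by simpa using hS.toFinset.isGLB_inf_id⟩

theorem FormulaDomain.sat_of_isGLB (𝓕 : FormulaDomain V D F) {S : Set F} (hS : S.Finite) {φ : F}
    (h : IsGLB S φ) {r : V → D} (hr : ∀ ψ ∈ S, 𝓕.Sat ψ r) : 𝓕.Sat φ r := by
  have h' : IsGLB S (hS.toFinset.inf id) := by simpa using hS.toFinset.isGLB_inf_id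
  rw [h.unique h']
  exact Finset.inf_induction (p := fun ψ => 𝓕.Sat ψ r) (𝓕.sat_top r)
    (fun _ h₁ _ h₂ => 𝓕.sat_inf _ _ r h₁ h₂)
    (fun ψ hψ => hr ψ (hS.mem_toFinset.1 hψ))

end

section

variable {PV Y D F : Type*} {nil : PV} [Fintype PV] [Lattice F] [BoundedOrder F]

/-- The join in the abstract transformer exists, since the formulas of the predecessors are among
those of finitely many states, and it is implied by each of them. -/
theorem QSDA.exists_isLUB_sat (A : QSDA PV Y F) (𝓕 : FormulaDomain (PV ⊕ Y) D F)
    (U : SymTree PV nil Y → Prop) (Ψ : F → F → Prop)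
    (hΨ : ∀ φ ψ ψ', Ψ φ ψ → Ψ φ ψ' → ψ = ψ') {t : SymTree PV nil Y} {φ ψ : F}
    (hφ : (t, φ) ∈ A.formulaLang nil) (hU : U t) (hψ : Ψ φ ψ) {r : PV ⊕ Y → D}
    (hr : 𝓕.Sat ψ r) :
    ∃ χ, IsLUB {ψ | ∃ t φ, (t, φ) ∈ A.formulaLang nil ∧ U t ∧ Ψ φ ψ} χ ∧ 𝓕.Sat χ r := by
  obtain ⟨χ, hχ⟩ := exists_isLUB_of_finite
    (S := {ψ | ∃ t φ, (t, φ) ∈ A.formulaLang nil ∧ U t ∧ Ψ φ ψ}) (by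
      refine Set.Finite.subset (s := ⋃ q, {ψ | Ψ (A.f q) ψ}) (Set.finite_iUnion fun q =>
        Set.Subsingleton.finite fun ψ h ψ' h' => hΨ _ _ _ h h') ?_
      rintro ψ ⟨t, φ, hφ, -, h⟩
      obtain ⟨q, -, rfl⟩ := A.mem_formulaLang.1 hφ
      exact Set.mem_iUnion.2 ⟨q, h⟩)
  exact ⟨χ, hχ, 𝓕.sat_of_le _ _ (hχ.1 ⟨t, φ, hφ, hU, hψ⟩) r hr⟩

theorem QSDA.exists_sat_of_mem_lang {A : QSDA PV Y F} {𝓕 : FormulaDomain (PV ⊕ Y) D F}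
    {H : Heap PV nil D} (hH : H ∈ A.lang nil 𝓕) {t : SymTree PV nil Y} (ht : t.shape = H.shape) :
    ∃ φ, (t, φ) ∈ A.formulaLang nil ∧ 𝓕.Sat φ (fun x => H.data (t.pos x)) := by
  obtain ⟨ρ, hρ, h⟩ := hH t ht
  exact ⟨_, ⟨ρ, hρ, rfl⟩, h⟩

/-- Soundness of the join for the assignments to the pointer variable `p`: the old value of `p`
witnesses the existential quantifier. -/
theorem exists_sat_assign (𝓕 : FormulaDomain (PV ⊕ Y) D F) {s : Stmt PV nil D} {A : QSDA PV Y F}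
    {H H' : Heap PV nil D} (hH : H ∈ A.lang nil 𝓕) (hs : ShapeStep s H.shape H'.shape) {p : PV}
    (hp : H'.shape.pval p ∈ H.shape.loc)
    (hq : ∀ q, q ≠ p → H'.shape.pval q = H.shape.pval q)
    (hcol : H'.shape.Collects H.shape.next)
    (hdata : ∀ u ∈ H'.shape.loc, u ∈ H.shape.loc → H'.data u = H.data u)
    {t' : SymTree PV nil Y} (ht' : t'.shape = H'.shape) :
    ∃ χ, IsLUB {ψ | ∃ t φ, (t, φ) ∈ A.formulaLang nil ∧ Update t s t' ∧
      𝓕.IsEx (Sum.inl p) φ ψ} χ ∧ 𝓕.Sat χ (fun x => H'.data (t'.pos x)) := by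
  have hloc : H'.shape.loc ⊆ H.shape.loc := by
    refine hcol.loc_subset (fun q => ?_) H.shape.next_mem
    by_cases h : q = p
    · exact h ▸ hp
    · exact hq q h ▸ H.shape.pval_mem q
  let t : SymTree PV nil Y := ⟨H.shape, t'.val, fun y => hloc (ht' ▸ t'.val_mem y),
    t'.val_injective⟩
  obtain ⟨φ, hφ, hsat⟩ := QSDA.exists_sat_of_mem_lang hH (t := t) rfl
  obtain ⟨ψ, hψ⟩ := 𝓕.exists_ex φ (Sum.inl p)
  refine A.exists_isLUB_sat 𝓕 (Update · s t') (𝓕.IsEx (Sum.inl p)) (fun _ _ _ => 𝓕.eq_of_iff) hφ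
    ⟨ht' ▸ hs, fun _ => rfl⟩ hψ ((hψ _).2 ⟨H.data (H.shape.pval p), ?_⟩)
  convert hsat using 1
  funext x
  unfold substData
  rcases x with q | y
  · by_cases h : q = p
    · subst h
      simp [t, SymTree.pos]
    · have h1 : t'.shape.pval q = H.shape.pval q := ht' ▸ hq q h
      simp only [Set.mem_singleton_iff, Sum.inl.injEq, h, if_false, SymTree.pos, Sum.elim_inl, t,
        h1]
      exact hdata _ (hq q h ▸ H'.shape.pval_mem q) (H.shape.pval_mem q)
  · simp only [Set.mem_singleton_iff, reduceCtorEq, if_false, SymTree.pos, Sum.elim_inr, t]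
    exact hdata _ (ht' ▸ t'.val_mem y) (hloc (ht' ▸ t'.val_mem y))

theorem exists_sat_setNext (𝓕 : FormulaDomain (PV ⊕ Y) D F) {A : QSDA PV Y F}
    {H H' : Heap PV nil D} (hH : H ∈ A.lang nil 𝓕) {p q : PV}
    (hs : ShapeStep (Stmt.setNext p q : Stmt PV nil D) H.shape H'.shape)
    (hdata : ∀ u ∈ H'.shape.loc, u ∈ H.shape.loc → H'.data u = H.data u)
    {t' : SymTree PV nil Y} (ht' : t'.shape = H'.shape) :
    ∃ χ, (t', χ) ∈ formulaPost 𝓕 (Stmt.setNext p q) (A.formulaLang nil) ∧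
      𝓕.Sat χ (fun x => H'.data (t'.pos x)) := by
  obtain ⟨hd, hpval, hcol⟩ := id hs
  have hloc : H'.shape.loc ⊆ H.shape.loc := by
    refine hcol.loc_subset (fun q => hpval ▸ H.shape.pval_mem q) fun a b hab => ?_
    by_cases h : a = H.shape.pval p
    · rw [h, Function.update_self, Option.some.injEq] at hab
      exact hab ▸ H.shape.pval_mem q
    · rw [Function.update_of_ne h] at hab
      exact H.shape.next_mem _ _ hab
  let t : SymTree PV nil Y := ⟨H.shape, t'.val, fun y => hloc (ht' ▸ t'.val_mem y),
    t'.val_injective⟩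
  obtain ⟨φ, hφ, hsat⟩ := QSDA.exists_sat_of_mem_lang hH (t := t) rfl
  have hr : (fun x => H'.data (t'.pos x)) = fun x => H.data (t.pos x) := by
    funext x
    have h1 : t.pos x = t'.pos x := by
      rcases x with q | y
      · exact (congrFun hpval q).symm.trans (ht' ▸ rfl)
      · rfl
    rw [h1]
    have h2 : t'.pos x ∈ H'.shape.loc := ht' ▸ t'.toLTree.pos_mem x
    exact hdata _ h2 (hloc h2)
  obtain ⟨χ, hχ, hχr⟩ := A.exists_isLUB_sat 𝓕 (Update · (Stmt.setNext p q : Stmt PV nil D) t')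
    Eq (fun _ _ _ h h' => h.symm.trans h') hφ ⟨ht' ▸ hs, fun _ => rfl⟩ rfl (hr ▸ hsat)
  refine ⟨χ, ?_, hχr⟩
  change IsLUB _ χ
  convert hχ using 1
  ext ψ
  exact ⟨fun ⟨t, h, h'⟩ => ⟨t, ψ, h, h', rfl⟩, fun ⟨t, _, h, h', e⟩ => ⟨t, e ▸ h, h'⟩⟩

theorem exists_sat_new [Fintype Y] (𝓕 : FormulaDomain (PV ⊕ Y) D F) {A : QSDA PV Y F}
    {H H' : Heap PV nil D} (hH : H ∈ A.lang nil 𝓕) (hcard : Fintype.card Y ≤ H.shape.loc.card)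
    {p : PV} {hp : p ≠ nil} (hs : ShapeStep (Stmt.new p hp : Stmt PV nil D) H.shape H'.shape)
    (hdata : ∀ u ∈ H'.shape.loc, u ∈ H.shape.loc → H'.data u = H.data u)
    {t' : SymTree PV nil Y} (ht' : t'.shape = H'.shape) :
    ∃ χ, (t', χ) ∈ formulaPost 𝓕 (Stmt.new p hp) (A.formulaLang nil) ∧
      𝓕.Sat χ (fun x => H'.data (t'.pos x)) := by
  classical
  obtain ⟨hx, hq, hcol⟩ := id hs
  have hloc : H'.shape.loc ⊆ insert (H'.shape.pval p) H.shape.loc := by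
    refine hcol.loc_subset (fun q => ?_) fun a b hab => ?_
    · by_cases h : q = p
      · exact h ▸ Finset.mem_insert_self _ _
      · exact Finset.mem_insert_of_mem (hq q h ▸ H.shape.pval_mem q)
    · refine Finset.mem_insert_of_mem ?_
      by_cases h : a = H'.shape.pval p
      · rw [h, Function.update_self, Option.some.injEq] at hab
        exact hab ▸ H.shape.dirty_mem
      · rw [Function.update_of_ne h] at hab
        exact H.shape.next_mem _ _ hab
  have hold : ∀ z, t'.val z ≠ t'.shape.pval p → t'.val z ∈ H.shape.loc := fun z hz =>
    (Finset.mem_insert.1 (hloc (ht' ▸ t'.val_mem z))).resolve_left (ht' ▸ hz)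
  have hptr : ∀ q, q ≠ p → t'.shape.pval q = H.shape.pval q := fun q h => ht' ▸ hq q h
  have hdp : ∀ q, q ≠ p → H'.data (t'.shape.pval q) = H.data (H.shape.pval q) := fun q h => by
    rw [hptr q h]
    exact hdata _ (hq q h ▸ H'.shape.pval_mem q) (H.shape.pval_mem q)
  have hdy : ∀ z, t'.val z ≠ t'.shape.pval p → H'.data (t'.val z) = H.data (t'.val z) := fun z h =>
    hdata _ (ht' ▸ t'.val_mem z) (hold z h)
  simp only [formulaPost, Set.mem_ofPred_eq]
  cases hu : t'.univLabel (t'.shape.pval p) with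
  | none =>
    have hne : ∀ z, t'.val z ≠ t'.shape.pval p := fun z hz => by
      rw [t'.univLabel_eq_some.2 hz] at hu
      cases hu
    let t : SymTree PV nil Y := ⟨H.shape, t'.val, fun y => hold y (hne y), t'.val_injective⟩
    obtain ⟨φ, hφ, hsat⟩ := QSDA.exists_sat_of_mem_lang hH (t := t) rfl
    obtain ⟨ψ, hψ⟩ := 𝓕.exists_ex φ (Sum.inl p)
    refine A.exists_isLUB_sat 𝓕 (UpdateNew · (Stmt.new p hp : Stmt PV nil D) p none t')
      (𝓕.IsEx (Sum.inl p)) (fun _ _ _ => 𝓕.eq_of_iff) hφ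
      ⟨ht' ▸ hs, fun _ h => (Option.some_ne_none _ h.symm).elim, fun _ _ => rfl⟩ hψ
      ((hψ _).2 ⟨H.data (H.shape.pval p), ?_⟩)
    convert hsat using 1
    funext x
    unfold substData
    rcases x with q | y
    · by_cases h : q = p
      · subst h
        simp [t, SymTree.pos]
      · simpa [h, t, SymTree.pos] using hdp q h
    · simpa [t, SymTree.pos] using hdy y (hne y)
  | some y =>
    have hy : t'.val y = t'.shape.pval p := t'.univLabel_eq_some.1 hu
    have hne : ∀ z, z ≠ y → t'.val z ≠ t'.shape.pval p := fun z hz h =>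
      hz (t'.val_injective (h.trans hy.symm))
    -- There are enough locations to place `y` in the old heap.
    obtain ⟨w, hw, hw'⟩ : ∃ w ∈ H.shape.loc, w ∉ (Finset.univ.erase y).image t'.val := by
      refine Finset.exists_mem_notMem_of_card_lt_card (lt_of_lt_of_le ?_ hcard)
      exact Finset.card_image_le.trans_lt (Finset.card_erase_lt_of_mem (Finset.mem_univ y))
    have hwz : ∀ z, z ≠ y → t'.val z ≠ w := fun z hz h =>
      hw' (Finset.mem_image.2 ⟨z, Finset.mem_erase.2 ⟨hz, Finset.mem_univ z⟩, h⟩)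
    let t : SymTree PV nil Y :=
      { shape := H.shape
        val := Function.update t'.val y w
        val_mem := fun z => by
          by_cases h : z = y
          · rw [h, Function.update_self]
            exact hw
          · rw [Function.update_of_ne h]
            exact hold z (hne z h)
        val_injective := by
          intro z z' h
          by_cases hz : z = y <;> by_cases hz' : z' = y
          · rw [hz, hz']
          · rw [hz, Function.update_self, Function.update_of_ne hz'] at h
            exact (hwz z' hz' h.symm).elim
          · rw [hz', Function.update_self, Function.update_of_ne hz] at h
            exact (hwz z hz h).elim
          · rw [Function.update_of_ne hz, Function.update_of_ne hz'] at h
            exact t'.val_injective h }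
    obtain ⟨φ, hφ, hsat⟩ := QSDA.exists_sat_of_mem_lang hH (t := t) rfl
    obtain ⟨θ, hθ⟩ := 𝓕.exists_ex φ (Sum.inl p)
    obtain ⟨ψ, hψ⟩ := 𝓕.exists_ex θ (Sum.inr y)
    obtain ⟨ε, hε⟩ := 𝓕.exists_eq (Sum.inr y) (Sum.inl p)
    have hr : 𝓕.Sat ψ (fun x => H'.data (t'.pos x)) := by
      refine (hψ _).2 ⟨H.data w, (hθ _).2 ⟨H.data (H.shape.pval p), ?_⟩⟩
      convert hsat using 1
      funext x
      unfold substData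
      rcases x with q | z
      · by_cases h : q = p
        · subst h
          simp [t, SymTree.pos]
        · simpa [h, t, SymTree.pos] using hdp q h
      · by_cases h : z = y
        · subst h
          simp [t, SymTree.pos]
        · simpa [h, t, SymTree.pos] using hdy z (hne z h)
    obtain ⟨χ, hχ, hχr⟩ := A.exists_isLUB_sat 𝓕
      (UpdateNew · (Stmt.new p hp : Stmt PV nil D) p (some y) t')
      (fun φ ψ => ∃ θ, 𝓕.IsEx (Sum.inl p) φ θ ∧ 𝓕.IsEx (Sum.inr y) θ ψ)
      (by
        rintro φ ψ ψ' ⟨θ, h, h'⟩ ⟨θ', h₁, h₁'⟩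
        obtain rfl := 𝓕.eq_of_iff h h₁
        exact 𝓕.eq_of_iff h' h₁')
      hφ ⟨ht' ▸ hs, fun z h => Option.some_injective _ h ▸ hy, fun z h =>
        (Function.update_of_ne (fun h' => h (congrArg some h'.symm)) _ _).symm⟩ ⟨θ, hθ, hψ⟩ hr
    refine ⟨ε ⊓ χ, ⟨χ, ε, ?_, hε, rfl⟩, 𝓕.sat_inf _ _ _ ((hε _).2 ?_) hχr⟩
    · convert hχ using 1
      ext ψ
      exact ⟨fun ⟨t, φ, θ, h, h', hθ⟩ => ⟨t, φ, h, h', θ, hθ⟩,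
        fun ⟨t, φ, h, h', θ, hθ⟩ => ⟨t, φ, θ, h, h', hθ⟩⟩
    · exact congrArg H'.data hy

/-- Every valuation tree of a successor heap satisfies a formula of the abstract successors. -/
theorem exists_sat_formulaPost [Fintype Y] (𝓕 : FormulaDomain (PV ⊕ Y) D F) (s : Stmt PV nil D)
    (hs : s.Expressible 𝓕) (A : QSDA PV Y F) {H H' : Heap PV nil D} (hH : H ∈ A.lang nil 𝓕)
    (hcard : s.Allocates → Fintype.card Y ≤ H.shape.loc.card)
    (hstep : ShapeStep s H.shape H'.shape) (hdata : DataStep s H H')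
    {t' : SymTree PV nil Y} (ht' : t'.shape = H'.shape) :
    ∃ φ, (t', φ) ∈ formulaPost 𝓕 s (A.formulaLang nil) ∧
      𝓕.Sat φ (fun x => H'.data (t'.pos x)) := by
  cases s with
  | assignNil p hp =>
    exact exists_sat_assign 𝓕 hH hstep (hstep.1 ▸ H.shape.pval_mem nil) hstep.2.1 hstep.2.2 hdata
      ht'
  | assign p q hp =>
    obtain ⟨χ, hχ, hr⟩ := exists_sat_assign 𝓕 hH hstep (hstep.1 ▸ H.shape.pval_mem q) hstep.2.1
      hstep.2.2 hdata ht'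
    obtain ⟨ε, hε⟩ := 𝓕.exists_eq (Sum.inl p) (Sum.inl q)
    refine ⟨ε ⊓ χ, ⟨χ, ε, hχ, hε, rfl⟩, 𝓕.sat_inf _ _ _ ((hε _).2 (congrArg H'.data ?_)) hr⟩
    change t'.shape.pval p = t'.shape.pval q
    rw [ht']
    by_cases h : q = p
    · rw [h]
    · rw [hstep.1, hstep.2.1 q h]
  | assignNext p q hp =>
    obtain ⟨χ, hχ, hr⟩ := exists_sat_assign 𝓕 hH hstep (H.shape.next_mem _ _ hstep.2.1)
      hstep.2.2.1 hstep.2.2.2 hdata ht'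
    have hfin : (insert χ {ε | ∃ v ∈ t'.label p, 𝓕.IsEq (Sum.inl p) v ε}).Finite := by
      refine Set.Finite.insert _ (Set.Finite.subset (s := ⋃ v, {ε | 𝓕.IsEq (Sum.inl p) v ε})
        (Set.finite_iUnion fun v => Set.Subsingleton.finite fun _ h _ h' => 𝓕.eq_of_iff h h') ?_)
      rintro ε ⟨v, -, h⟩
      exact Set.mem_iUnion.2 ⟨v, h⟩
    obtain ⟨φ, hφ⟩ := exists_isGLB_of_finite hfin
    refine ⟨φ, ⟨χ, hχ, hφ⟩, 𝓕.sat_of_isGLB hfin hφ ?_⟩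
    rintro ψ (rfl | ⟨v, hv, h⟩)
    · exact hr
    · exact (h _).2 (congrArg H'.data (show t'.pos v = _ from hv).symm)
  | setNextNil p => exact exists_sat_setNext (q := nil) 𝓕 hH hstep hdata ht'
  | setNext p q => exact exists_sat_setNext 𝓕 hH hstep hdata ht'
  | setData p e =>
    obtain ⟨hd, hsh⟩ := hstep
    obtain ⟨φ, hφ, hsat⟩ := QSDA.exists_sat_of_mem_lang hH (ht'.trans hsh)
    obtain ⟨ψ, hψ⟩ := hs (t'.label p) φ rfl
    have hp : t'.shape.pval p = H.shape.pval p := by rw [ht', hsh]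
    have hr : substData (fun x => H'.data (t'.pos x)) (t'.label p) (H.data (H.shape.pval p)) =
        fun x => H.data (t'.pos x) := by
      funext x
      unfold substData
      by_cases hx : x ∈ t'.label p
      · rw [if_pos hx, ← hp]
        exact congrArg H.data (show t'.pos x = _ from hx).symm
      · rw [if_neg hx]
        refine hdata.2 _ ?_ fun h => hx (h.trans hp.symm)
        rw [← hsh, ← ht']
        exact t'.toLTree.pos_mem x
    refine ⟨ψ, ⟨φ, hφ, hψ⟩, (hψ _).2 ⟨H.data (H.shape.pval p), hr ▸ hsat, fun v hv => ?_⟩⟩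
    rw [hr]
    have h1 : t'.pos v = H.shape.pval p := (show t'.pos v = _ from hv).trans hp
    rw [h1, hdata.1]
    refine congrArg e (funext fun q => ?_)
    change H.data (H.shape.pval q) = H.data (t'.shape.pval q)
    rw [ht', hsh]
  | assumeStruct ψ =>
    obtain ⟨hψ, hsh⟩ := hstep
    obtain ⟨φ, hφ, hsat⟩ := QSDA.exists_sat_of_mem_lang hH (ht'.trans hsh)
    refine ⟨φ, ⟨hφ, ?_⟩, ?_⟩
    · change ψ.Holds t'.shape
      rw [ht', hsh]
      exact hψ
    · convert hsat using 2 with x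
      have hx : t'.pos x ∈ H'.shape.loc := ht' ▸ t'.toLTree.pos_mem x
      exact hdata _ hx (hsh ▸ hx)
  | assumeData P =>
    obtain ⟨φ, hφ, hsat⟩ := QSDA.exists_sat_of_mem_lang hH (ht'.trans hstep)
    obtain ⟨c, hc⟩ := hs
    have hr : (fun x => H'.data (t'.pos x)) = fun x => H.data (t'.pos x) := by
      funext x
      have hx : t'.pos x ∈ H'.shape.loc := ht' ▸ t'.toLTree.pos_mem x
      exact hdata.2 _ ((show H'.shape = H.shape from hstep) ▸ hx)
    rw [hr]
    refine ⟨φ ⊓ c, ⟨φ, c, hφ, hc, rfl⟩, 𝓕.sat_inf _ _ _ hsat ((hc _).2 ?_)⟩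
    convert hdata.1 using 1
    funext q
    change H.data (t'.shape.pval q) = H.data (H.shape.pval q)
    rw [ht', show H'.shape = H.shape from hstep]
  | new p hp => exact exists_sat_new 𝓕 hH (hcard trivial) hstep hdata ht'

end

theorem mainTheorem2 {PV Y D F : Type*} [Fintype PV] [Fintype Y] [Lattice F] [BoundedOrder F]
    (nil : PV) (𝓕 : FormulaDomain (PV ⊕ Y) D F) (s : Stmt PV nil D) (hs : s.Expressible 𝓕)
    (A : QSDA PV Y F) :
    (∃ A', IsAbstractPost nil 𝓕 s A A') ∧
    ∀ A', IsAbstractPost nil 𝓕 s A A' →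
      concretePost s {H | H ∈ A.lang nil 𝓕 ∧ (s.Allocates → Fintype.card Y ≤ H.shape.loc.card)} ⊆
        A'.lang nil 𝓕 := by
  classical
  constructor
  · have h : ∃ n, ∃ B : QSDA PV Y F,
        B.formulaLang nil = formulaPost 𝓕 s (A.formulaLang nil) ∧ B.n = n := by
      obtain ⟨B, hB⟩ := exists_formulaLang_eq_formulaPost 𝓕 s A
      exact ⟨_, B, hB, rfl⟩
    obtain ⟨A', hA', hn⟩ := Nat.find_spec h
    exact ⟨A', hA', fun B hB => hn ▸ Nat.find_min' h ⟨B, hB, rfl⟩⟩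
  · rintro A' ⟨hA', -⟩ H' ⟨H, ⟨hH, hcard⟩, hstep, hdata⟩ t' ht'
    obtain ⟨φ, hφ, hsat⟩ := exists_sat_formulaPost 𝓕 s hs A hH hcard hstep hdata ht'
    rw [← hA'] at hφ
    obtain ⟨ρ, hρ, hd⟩ := hφ
    refine ⟨ρ, hρ, ?_⟩
    rw [hd]
    exact hsat
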